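/- Let $n\ge 1$ and let $W=\mathfrak S_n$ with simple transpositions $s_i=(i,i+1)$, $S=\{s_1,\dots,s_{n-1}\}$, length $\ell$ (the number of inversions) and Bruhat graph $\mathcal B(W)$, with an edge $x\to y$ if $y=tx$ for a transposition $t$ and $\ell(x)<\ell(y)$. The Bruhat order is given by $x\le y$ if there is a directed path from $x$ to $y$; $[x,y]$ denotes its intervals, and $d(x,y)$ (for $x\le y$) the minimal length of a directed path from $x$ to $y$. *Hypercube decompositions.* For a finite set $E$ let $H_E$ be the directed graph on the subsets of $E$ with edges $A\to A\cup\{a\}$, $a\in E\setminus A$. Let $p\in W$ and let $E$ be a set of edges of $\mathcal B(W)$ with target $p$. $E$ spans a hypercube if there is a unique embedding of directed graphs (an injective map on vertices sending edges to edges) $\theta:H_E\to\mathcal B(W)$ with $\theta(E)=p$ that sends the edge $E\setminus\{\alpha\}\to E$ to $\alpha$ for each $\alpha\in E$. $E$ spans a hypercube cluster if every subset of $E$ whose edges have pairwise Bruhat-incomparable sources spans a hypercube. An element $z\in[u,v]$ is a hypercube decomposition of $[u,v]$ if 1. whenever $x\in[u,v]$, $a_1\ne a_2$ and $y$ lie in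 $[z,v]$, and $x\to a_1\to y$, $x\to a_2\to y$, then $x\in[z,v]$; 2. for all $p\in[z,v]$ the set of edges $x\to p$ with $x\in[u,v]\setminus[z,v]$ spans a hypercube cluster. It is amazing if for all $x\in[u,v]$ the set $[z,v]\cap[x,v]$ has a minimum $z\vee x$, and $z\vee x$ is a hypercube decomposition of $[x,v]$. *Double shortcuts.* For $z\in[u,v]$ let $W^z_{[u,v]}$ be the set of all $p\in[z,v]$ such that every directed path from $u$ to $p$ of length $d(u,p)$ meets $[z,v]$ only in $p$. For amazing hypercube decompositions $z,z'$ of $[u,v]$ let $DS(z,z')$ be the multiset $$\{(d(u,p)+d(p,b),\,b)\;:\;p\in W^z_{[u,v]},\ b\in W^{z'\vee p}_{[p,v]}\},$$ with one entry for every such pair $(p,b)$. Consider the equivalence relation on the set of amazing hypercube decompositions of $[u,v]$ generated by $z\sim z'$ if $DS(z,z')=DS(z',z)$. **Corollary.** Let $u\le v$ in $\mathfrak S_n$. Let $W'$ and $W''$ be the subgroups generated by the $s_i$ with $i\ne n-1$ and by the $s_i$ with $i\neq1$, respectively. Then the four minima in the Bruhat order $$z_n=\min([u,v]\cap W'v),\quad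 z_1=\min([u,v]\cap W''v),\quad z^n=\min([u,v]\cap vW'),\quad z^1=\min([u,v]\cap vW'')$$ exist, are amazing hypercube decompositions of $[u,v]$ (the standard ones), and all belong to the same equivalence class. Consequently, if $[u,v]$ has no hypercube decompositions other than these four, then the equivalence relation has exactly one class. -/

import Mathlib

namespace BruhatSn

open Equiv

variable {n : ℕ}

/-- The Coxeter length of `w` in the symmetric group with respect to the simple transpositions:
the number of inversions of `w`. -/
def length (w : Perm (Fin n)) : ℕ :=
  (Finset.univ.filter fun q : Fin n × Fin n => q.1 < q.2 ∧ w q.2 < w q.1).card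

/-- The edges `x → y` of the Bruhat graph: `y = t x` for a reflection (transposition) `t`, and
the length of `y` is larger than that of `x`. -/
def Edge (x y : Perm (Fin n)) : Prop :=
  (∃ i j : Fin n, i ≠ j ∧ y = swap i j * x) ∧ length x < length y

/-- The Bruhat order: `x ≤ y` if there is a directed path from `x` to `y` in the Bruhat graph. -/
def LE (x y : Perm (Fin n)) : Prop := Relation.ReflTransGen Edge x y

/-- The Bruhat interval `[u, v]`. -/
def interval (u v : Perm (Fin n)) : Set (Perm (Fin n)) := {x | LE u x ∧ LE x v}

/-- `m` is the minimum of the set `A` in the Bruhat order. -/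
def IsMinimum (A : Set (Perm (Fin n))) (m : Perm (Fin n)) : Prop := m ∈ A ∧ ∀ x ∈ A, LE m x

/-! ### Hypercube decompositions -/

/-- The edges of the hypercube `H_E`, whose vertices are the subsets of `E`: the second vertex is
obtained from the first by adding one element. -/
def CubeEdge {E : Set (Perm (Fin n))} (A B : Set E) : Prop := ∃ a, a ∉ A ∧ B = insert a A

/-- `θ` is an embedding of directed graphs of the hypercube `H_E` into the Bruhat graph. -/
structure IsCubeEmbedding (E : Set (Perm (Fin n))) (θ : Set E → Perm (Fin n)) : Prop where
  injective : Function.Injective θ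
  map_edge : ∀ A B : Set E, CubeEdge A B → Edge (θ A) (θ B)

/-- A set of edges with common target `p` is given by the set `E` of its sources. It spans
a hypercube if there is a unique embedding of `H_E` that sends the vertex `E` to `p` and, for all
`a ∈ E`, the vertex `E ∖ {a}` to `a`, i.e. the edge `E ∖ {a} → E` to `a → p`. (The condition
`θ E = p` is implied by the others unless `E` is empty.) -/
def SpansHypercube (p : Perm (Fin n)) (E : Set (Perm (Fin n))) : Prop :=
  ∃! θ : Set E → Perm (Fin n),
    IsCubeEmbedding E θ ∧ θ Set.univ = p ∧ ∀ a : E, θ (Set.univ \ {a}) = a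

/-- Every subset of `E` (sources of edges with target `p`) consisting of pairwise incomparable
elements spans a hypercube. -/
def SpansHypercubeCluster (p : Perm (Fin n)) (E : Set (Perm (Fin n))) : Prop :=
  ∀ E' ⊆ E, (∀ x ∈ E', ∀ y ∈ E', x ≠ y → ¬ LE x y) → SpansHypercube p E'

/-- `[z, v]` is diamond complete with respect to `[u, v]`. -/
def DiamondComplete (u v z : Perm (Fin n)) : Prop :=
  ∀ x ∈ interval u v, ∀ a₁ ∈ interval z v, ∀ a₂ ∈ interval z v, ∀ y ∈ interval z v,
    a₁ ≠ a₂ → Edge x a₁ → Edge a₁ y → Edge x a₂ → Edge a₂ y → x ∈ interval z v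

/-- `z` is a hypercube decomposition of the interval `[u, v]`. -/
structure IsHypercubeDecomposition (u v z : Perm (Fin n)) : Prop where
  mem : z ∈ interval u v
  diamond : DiamondComplete u v z
  cluster : ∀ p ∈ interval z v,
    SpansHypercubeCluster p {x | x ∈ interval u v \ interval z v ∧ Edge x p}

/-- `m` is the join `z ∨ x`, the minimum of `[z, v] ∩ [x, v]`. -/
def IsJoin (v z x m : Perm (Fin n)) : Prop := IsMinimum (interval z v ∩ interval x v) m

/-- `z` is an amazing hypercube decomposition of `[u, v]`. -/
structure IsAmazing (u v z : Perm (Fin n)) : Prop where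
  isHypercubeDecomposition : IsHypercubeDecomposition u v z
  join : ∀ x ∈ interval u v, ∃ m, IsJoin v z x m ∧ IsHypercubeDecomposition x v m

/-! ### Shortcuts and double shortcuts -/

/-- Paths in the Bruhat graph. -/
abbrev BruhatPath (n : ℕ) : Type :=
  RelSeries {q : Perm (Fin n) × Perm (Fin n) | Edge q.1 q.2}

/-- `Γ` is a path from `u` to `p`. -/
def IsPath (u p : Perm (Fin n)) (Γ : BruhatPath n) : Prop := Γ.head = u ∧ Γ.last = p

/-- The distance `d(u, p)`: the minimal length of a path from `u` to `p`
(used only when `u ≤ p`, so that there is a path). -/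
noncomputable def dist (u p : Perm (Fin n)) : ℕ :=
  sInf {r | ∃ Γ : BruhatPath n, IsPath u p Γ ∧ Γ.length = r}

/-- The set of shortcuts for `[u, v]` with respect to `z`. -/
def shortcuts (u v z : Perm (Fin n)) : Set (Perm (Fin n)) :=
  {p | p ∈ interval z v ∧ ∀ Γ : BruhatPath n, IsPath u p Γ → Γ.length = dist u p →
    Set.range Γ.toFun ∩ interval z v = {p}}

open Classical in
/-- The multiset `DS(z, z')` of the pairs `(d(u,p) + d(p,b), b)`, where `(p, b)` runs over all
pairs such that `p` is a shortcut for `[u, v]` with respect to `z` and `b` is a shortcut for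
`[p, v]` with respect to `z' ∨ p`. -/
noncomputable def doubleShortcuts (u v z z' : Perm (Fin n)) : Multiset (ℕ × Perm (Fin n)) :=
  (Finset.univ.filter fun q : Perm (Fin n) × Perm (Fin n) =>
    q.1 ∈ shortcuts u v z ∧ ∃ m, IsJoin v z' q.1 m ∧ q.2 ∈ shortcuts q.1 v m).val.map
      fun q => (dist u q.1 + dist q.1 q.2, q.2)

/-- The amazing hypercube decompositions of `[u, v]`. -/
abbrev Amazing (u v : Perm (Fin n)) : Type := {z : Perm (Fin n) // IsAmazing u v z}

/-- The equivalence relation on the amazing hypercube decompositions of `[u, v]` generated by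
`z ∼ z'` if `DS(z, z') = DS(z', z)`. -/
def SameClass (u v : Perm (Fin n)) : Amazing u v → Amazing u v → Prop :=
  Relation.EqvGen fun z z' => doubleShortcuts u v z z' = doubleShortcuts u v z' z

/-! ### Standard hypercube decompositions -/

/-- The parabolic subgroup generated by all the simple transpositions `s_1, …, s_{n-1}`
except `s_k`. Here `s_{i+1}` exchanges the elements numbered `i + 1` and `i + 2`, which are `i`
and `i + 1` in `Fin n`. -/
def parabolic (n k : ℕ) : Subgroup (Perm (Fin n)) :=
  Subgroup.closure {s | ∃ (i : ℕ) (h : i + 1 < n), i + 1 ≠ k ∧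
    s = swap ⟨i, Nat.lt_of_succ_lt h⟩ ⟨i + 1, h⟩}

/-- `z` is the minimum of `[u, v] ∩ W_{S ∖ {s_k}} v`; for `k = n - 1` and `k = 1` this is
`z_n` and `z_1`. -/
def IsLeftStandard (k : ℕ) (u v z : Perm (Fin n)) : Prop :=
  IsMinimum (interval u v ∩ {x | ∃ w ∈ parabolic n k, x = w * v}) z

/-- `z` is the minimum of `[u, v] ∩ v W_{S ∖ {s_k}}`; for `k = n - 1` and `k = 1` this is
`z^n` and `z^1`. -/
def IsRightStandard (k : ℕ) (u v z : Perm (Fin n)) : Prop :=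
  IsMinimum (interval u v ∩ {x | ∃ w ∈ parabolic n k, x = v * w}) z

end BruhatSn

namespace BruhatSn

open Equiv Polynomial

/-! ### The Bruhat graph and the tableau criterion. -/

section

variable {n : ℕ}

/-! ### Edges of the Bruhat graph -/

/-! Let `pos x` be the position of the largest value of `x`. The coset `W'v` consists of the `x`
with `pos x = pos v`, and the other three cosets become the same condition after applying an
automorphism `φ` of the Bruhat graph: inversion, conjugation by the longest element, or both. So a
single kind of decomposition is studied, with `φ` as a parameter.

Since `pos` weakly decreases along edges, the elements of `[u,v]` with `pos x = pos v` are exactly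
those above their minimum, which exists by `exists_minimum_pos`. An edge into `p` from outside this
set exchanges the largest value with one at a later position. Pairwise incomparable sources
correspond to positions at which `p` increases, and the hypercube they span consists of the elements
`shift (pos p) p B`. Joins are again standard, whence amazingness. An element `p` is a shortcut
exactly when `u` is such a shift of `p`, and then `d(u,p)` is the size of `B`
(`IsStandard.mem_shortcuts_iff`).

The symmetry of double shortcuts comes from the R-polynomials. By `rPoly_eq_sum`, `R̃_{u,v}` is the
sum of `q^{d(u,p)} R̃_{p,v}` over shortcuts `p`; this holds for each `φ` because the automorphisms
in question preserve R-polynomials. Expanding with `φ` and then with `ψ` gives `R̃_{u,v} = ∑_b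
D(b,u) R̃_{b,v}`, where `D(b,u)` counts double shortcuts ending at `b` and does not depend on `v`.
The left side and the range of `b` do not depend on the order of `φ` and `ψ`. As `R̃_{b,b} = 1` and
`R̃_{c,b} = 0` unless `c ≤ b`, the system is unitriangular, so `D` is the same for both orders
(`doublePoly_comm`). Its coefficients are the multiplicities in `DS`, so any two standard
decompositions are directly related. -/

theorem length_lt_length_mul_swap {x : Perm (Fin n)} {a b : Fin n} (hab : a < b)
    (hx : x a < x b) : length x < length (x * swap a b) := by
  classical
  unfold length
  -- An injection from the inversions of `x` to those of `x * swap a b` that misses `(a, b)`: the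
  -- positions are moved by the transposition if this keeps their order, and otherwise the pair
  -- itself remains an inversion.
  let f : Fin n × Fin n → Fin n × Fin n := fun q =>
    if swap a b q.1 < swap a b q.2 then (swap a b q.1, swap a b q.2) else q
  have hne : x a ≠ x b := hx.ne
  have key : ∀ i j : Fin n, i < j → x j < x i → ¬ swap a b i < swap a b j →
      (x * swap a b) j < (x * swap a b) i := by
    intro i j hij hji hs
    simp only [Perm.mul_apply]
    by_cases hia : i = a
    · subst hia
      by_cases hjb : j = b
      · subst hjb; exact absurd hji hx.asymm
      · rw [swap_apply_left, swap_apply_of_ne_of_ne hij.ne' hjb]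
        exact hji.trans hx
    · by_cases hjb : j = b
      · subst hjb
        by_cases hib : i = j
        · exact absurd hib hij.ne
        · rw [swap_apply_right, swap_apply_of_ne_of_ne hia hib]
          exact hx.trans hji
      · by_cases hja : j = a
        · subst hja
          exfalso; apply hs
          rw [swap_apply_left, swap_apply_of_ne_of_ne hia (hij.trans hab).ne]
          exact hij.trans hab
        · by_cases hib : i = b
          · subst hib
            exfalso; apply hs
            rw [swap_apply_right, swap_apply_of_ne_of_ne hja hjb]
            exact hab.trans hij
          · rw [swap_apply_of_ne_of_ne hia hib, swap_apply_of_ne_of_ne hja hjb]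
            exact hji
  have hsub : (Finset.univ.filter fun q : Fin n × Fin n => q.1 < q.2 ∧ x q.2 < x q.1).image f ⊂
      Finset.univ.filter fun q : Fin n × Fin n =>
        q.1 < q.2 ∧ (x * swap a b) q.2 < (x * swap a b) q.1 := by
    rw [Finset.ssubset_iff_of_subset]
    · refine ⟨(a, b), ?_, ?_⟩
      · rw [Finset.mem_filter]
        exact ⟨Finset.mem_univ _, hab, by simpa using hx⟩
      · simp only [Finset.mem_image, Finset.mem_filter, Finset.mem_univ, true_and, Prod.exists,
          not_exists, not_and, f]
        rintro i j ⟨hij, hji⟩ h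
        split_ifs at h with hs
        · simp only [Prod.mk.injEq] at h
          have h1 : i = b := by
            rw [swap_apply_eq_iff] at h; simpa using h.1
          have h2 : j = a := by
            have := h.2; rw [swap_apply_eq_iff] at this; simpa using this
          rw [h1, h2] at hij
          exact hij.asymm hab
        · simp only [Prod.mk.injEq] at h
          rw [h.1, h.2] at hji
          exact hji.asymm hx
    · intro q hq
      simp only [Finset.mem_image, Finset.mem_filter, Finset.mem_univ, true_and, Prod.exists, f]
        at hq ⊢
      obtain ⟨i, j, ⟨hij, hji⟩, rfl⟩ := hq
      split_ifs with hs
      · exact ⟨hs, by simpa [Perm.mul_apply] using hji⟩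
      · exact ⟨hij, key i j hij hji hs⟩
  have hinj : Set.InjOn f
      (Finset.univ.filter fun q : Fin n × Fin n => q.1 < q.2 ∧ x q.2 < x q.1) := by
    rintro ⟨i, j⟩ h ⟨k, l⟩ h' heq
    replace h := (Finset.mem_filter.1 (Finset.mem_coe.1 h)).2
    replace h' := (Finset.mem_filter.1 (Finset.mem_coe.1 h')).2
    simp only [f] at heq
    split_ifs at heq with h1 h2 h2
    · simpa using heq
    · simp only [Prod.mk.injEq] at heq
      rw [← heq.1, ← heq.2, swap_apply_self, swap_apply_self] at h2
      exact absurd h.1 h2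
    · simp only [Prod.mk.injEq] at heq
      rw [heq.1, heq.2, swap_apply_self, swap_apply_self] at h1
      exact absurd h'.1 h1
    · exact heq
  rw [← Finset.card_image_of_injOn hinj]
  exact Finset.card_lt_card hsub

theorem edge_mul_swap_iff {x : Perm (Fin n)} {a b : Fin n} (hab : a < b) :
    Edge x (x * swap a b) ↔ x a < x b := by
  constructor
  · intro h
    by_contra hx
    have hx' : x b < x a := lt_of_le_of_ne (not_lt.1 hx) (fun h => hab.ne' (x.injective h))
    have := length_lt_length_mul_swap (x := x * swap a b) hab (by simpa using hx')
    rw [mul_assoc, swap_mul_self, mul_one] at this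
    exact this.asymm h.2
  · intro h
    refine ⟨⟨x a, x b, h.ne, mul_swap_eq_swap_mul _ _ _⟩, length_lt_length_mul_swap hab h⟩

/-- Conjugation turns a transposition of values on the left into one of positions on the right,
where going up means that the two values were in increasing order. -/
theorem edge_iff {x y : Perm (Fin n)} :
    Edge x y ↔ ∃ a b, a < b ∧ x a < x b ∧ y = x * swap a b := by
  constructor
  · intro h
    obtain ⟨⟨i, j, hij, rfl⟩, hl⟩ := h
    have e : swap i j * x = x * swap (x⁻¹ i) (x⁻¹ j) := swap_mul_eq_mul_swap _ _ _
    rcases lt_or_gt_of_ne (fun h => hij (x⁻¹.injective h) : x⁻¹ i ≠ x⁻¹ j) with h | h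
    · exact ⟨_, _, h, (edge_mul_swap_iff h).1 ⟨⟨i, j, hij, e.symm⟩, e ▸ hl⟩, e⟩
    · rw [swap_comm (x⁻¹ i)] at e
      exact ⟨_, _, h, (edge_mul_swap_iff h).1 ⟨⟨i, j, hij, e.symm⟩, e ▸ hl⟩, e⟩
  · rintro ⟨a, b, hab, hx, rfl⟩
    exact (edge_mul_swap_iff hab).2 hx

theorem Edge.inv {x y : Perm (Fin n)} (h : Edge x y) : Edge x⁻¹ y⁻¹ := by
  obtain ⟨a, b, hab, hx, rfl⟩ := edge_iff.1 h
  refine edge_iff.2 ⟨x a, x b, hx, by simpa using hab, ?_⟩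
  rw [mul_inv_rev, swap_inv, swap_mul_eq_mul_swap]
  simp

/-- Conjugation by the longest element. -/
def revConj (x : Perm (Fin n)) : Perm (Fin n) := Fin.revPerm * x * Fin.revPerm

theorem revConj_apply (x : Perm (Fin n)) (i : Fin n) : revConj x i = Fin.rev (x (Fin.rev i)) := rfl

theorem revConj_revConj (x : Perm (Fin n)) : revConj (revConj x) = x := by
  ext i; simp [revConj_apply]

theorem revConj_mul (x y : Perm (Fin n)) : revConj (x * y) = revConj x * revConj y := by
  ext i; simp [revConj_apply]

theorem revConj_inv (x : Perm (Fin n)) : revConj x⁻¹ = (revConj x)⁻¹ := by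
  rw [eq_comm, inv_eq_iff_mul_eq_one, ← revConj_mul, mul_inv_cancel]
  ext i; simp [revConj_apply]

theorem revConj_swap (a b : Fin n) : revConj (swap a b) = swap (Fin.rev a) (Fin.rev b) := by
  ext i
  simp only [revConj_apply, swap_apply_def, Fin.rev_eq_iff]
  split_ifs <;> simp

theorem Edge.revConj {x y : Perm (Fin n)} (h : Edge x y) :
    Edge (BruhatSn.revConj x) (BruhatSn.revConj y) := by
  obtain ⟨a, b, hab, hx, rfl⟩ := edge_iff.1 h
  refine edge_iff.2 ⟨Fin.rev b, Fin.rev a, by simpa using hab, ?_, ?_⟩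
  · simpa [revConj_apply] using hx
  · rw [revConj_mul, revConj_swap, swap_comm]

/-! ### The Bruhat order -/

theorem LE.refl (x : Perm (Fin n)) : LE x x := Relation.ReflTransGen.refl

theorem LE.trans {x y z : Perm (Fin n)} (h : LE x y) (h' : LE y z) : LE x z :=
  Relation.ReflTransGen.trans h h'

theorem Edge.le {x y : Perm (Fin n)} (h : Edge x y) : LE x y := Relation.ReflTransGen.single h

theorem LE.eq_or_length_lt {x y : Perm (Fin n)} (h : LE x y) : x = y ∨ length x < length y := by
  induction h with
  | refl => exact Or.inl rfl
  | tail _ h ih =>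
    right
    rcases ih with rfl | ih
    · exact h.2
    · exact ih.trans h.2

/-- The rank function of a permutation: the number of positions `< i` with values `≥ j`. -/
def rank (w : Perm (Fin n)) (i j : ℕ) : ℤ :=
  ∑ a : Fin n, (if a.val < i then 1 else 0) * (if j ≤ (w a).val then 1 else 0)

theorem rank_mul_swap (x : Perm (Fin n)) {a b : Fin n} (hab : a ≠ b) (i j : ℕ) :
    rank (x * swap a b) i j = rank x i j +
      ((if a.val < i then 1 else 0) - (if b.val < i then 1 else 0)) *
      ((if j ≤ (x b).val then 1 else 0) - (if j ≤ (x a).val then 1 else 0)) := by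
  rw [← sub_eq_iff_eq_add']
  unfold rank
  rw [← Equiv.sum_comp (swap a b), ← Finset.sum_sub_distrib, Fintype.sum_eq_add a b hab]
  · simp only [Perm.mul_apply, swap_apply_left, swap_apply_right]
    ring
  · rintro c ⟨hca, hcb⟩
    simp [swap_apply_of_ne_of_ne hca hcb]

theorem rank_succ (x : Perm (Fin n)) (a : Fin n) (j : ℕ) :
    rank x (a + 1) j = rank x a j + if j ≤ (x a).val then 1 else 0 := by
  rw [← sub_eq_iff_eq_add']
  unfold rank
  rw [← Finset.sum_sub_distrib, Fintype.sum_eq_single a]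
  · simp
  · intro c hc
    have : c.val ≠ a.val := fun h => hc (Fin.ext h)
    rw [← sub_mul, mul_eq_zero]
    left
    split_ifs <;> omega

theorem Edge.rank_le {x y : Perm (Fin n)} (h : Edge x y) (i j : ℕ) : rank x i j ≤ rank y i j := by
  obtain ⟨a, b, hab, hx, rfl⟩ := edge_iff.1 h
  rw [rank_mul_swap x hab.ne]
  rw [Fin.lt_def] at hab hx
  split_ifs <;> omega

theorem LE.rank_le {x y : Perm (Fin n)} (h : LE x y) (i j : ℕ) : rank x i j ≤ rank y i j := by
  induction h with
  | refl => rfl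
  | tail _ h ih => exact ih.trans (h.rank_le i j)

theorem length_le_card (x : Perm (Fin n)) : length x ≤ Fintype.card (Fin n × Fin n) :=
  Finset.card_le_univ _

/-- Take the first position `a` where `u` and `x` differ, so that `u a < x a`, and exchange it with
the first later position `b` whose value lies in `(u a, x a]`. The rank grows, by one, only for `a <
i ≤ b` and `u a < j ≤ u b`, where the inequality was strict. -/
theorem exists_edge_of_rank_le {u x : Perm (Fin n)} (h : ∀ i j, rank u i j ≤ rank x i j)
    (hne : u ≠ x) : ∃ u', Edge u u' ∧ ∀ i j, rank u' i j ≤ rank x i j := by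
  classical
  obtain ⟨c, hc⟩ : ∃ c, u c ≠ x c := by
    by_contra! H
    exact hne (Equiv.ext H)
  obtain ⟨a, ha, hmin⟩ := (Finset.univ.filter fun c => u c ≠ x c).exists_minimal
    ⟨c, by simpa using hc⟩
  replace ha := (Finset.mem_filter.1 ha).2
  have heq : ∀ c, c < a → u c = x c := by
    intro c hca
    by_contra hcc
    exact absurd (hmin (by simpa using hcc) hca.le) (not_le.2 hca)
  have hpre : ∀ j, rank u a j = rank x a j := by
    intro j
    unfold rank
    refine Finset.sum_congr rfl fun c _ => ?_
    by_cases hca : c < a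
    · rw [heq c hca]
    · rw [Fin.lt_def] at hca; simp [hca]
  have hua : u a < x a := by
    refine lt_of_le_of_ne ?_ ha
    have := h (a + 1) (u a)
    rw [rank_succ, rank_succ, hpre] at this
    simp only [le_refl, if_true] at this
    by_contra hlt
    rw [Fin.le_def] at hlt
    simp [hlt] at this
  obtain ⟨b, hb, hbmin⟩ := (Finset.univ.filter fun b =>
    a < b ∧ u a < u b ∧ u b ≤ x a).exists_minimal
    ⟨u⁻¹ (x a), by
      have hx : u (u⁻¹ (x a)) = x a := Equiv.apply_symm_apply u _
      simp only [Finset.mem_filter, Finset.mem_univ, true_and, hx, le_refl, and_true, hua]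
      by_contra hlt
      rcases (not_lt.1 hlt).eq_or_lt with h | h
      · exact hua.ne ((congrArg u h).symm.trans hx)
      · have := heq _ h
        rw [hx] at this
        exact h.ne (x.injective this).symm⟩
  simp only [Finset.mem_filter, Finset.mem_univ, true_and] at hb
  have hb' : ∀ c, a < c → c < b → ¬ (u a < u c ∧ u c ≤ x a) := by
    intro c hac hcb H
    exact absurd (hbmin (by simpa using ⟨hac, H⟩) hcb.le) (not_le.2 hcb)
  refine ⟨u * swap a b, edge_iff.2 ⟨a, b, hb.1, hb.2.1, rfl⟩, fun i j => ?_⟩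
  rw [rank_mul_swap u hb.1.ne]
  have hij := h i j
  by_cases hcase : (a.val < i ∧ ¬ b.val < i) ∧ (j ≤ (u b).val ∧ ¬ j ≤ (u a).val)
  · obtain ⟨⟨h1, h2⟩, h3, h4⟩ := hcase
    simp only [h1, h2, h3, h4, if_true, if_false]
    -- The differences count positions before `i` with values in `[j, x a]`. By the choice of `b`,
    -- `u` has none of these from `a` on, whereas `x` has one at `a`.
    have key : rank u i j - rank u i (x a + 1) + 1 ≤ rank x i j - rank x i (x a + 1) := by
      have : (1 : ℤ) = ∑ c : Fin n, if c = a then 1 else 0 := by simp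
      rw [this]
      unfold rank
      rw [← Finset.sum_sub_distrib, ← Finset.sum_sub_distrib, ← Finset.sum_add_distrib]
      refine Finset.sum_le_sum fun c _ => ?_
      rcases lt_trichotomy c a with hca | rfl | hca
      · rw [heq c hca]; simp [hca.ne]
      · have h5 : j ≤ (x c).val := h3.trans hb.2.2
        have h6 : ¬ (x c).val + 1 ≤ (u c).val := by rw [Fin.lt_def] at hua; omega
        simp [h1, h4, h5, h6]
      · rw [if_neg hca.ne']
        by_cases hci : c.val < i
        · have h5 := hb' c hca (Fin.lt_def.2 (by omega))
          have h6 := hb.2.2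
          simp only [Fin.lt_def, Fin.le_def] at h5 h6 hca
          have h7 : j ≤ (u c).val ↔ (x a).val + 1 ≤ (u c).val := by omega
          simp only [h7, hci, if_true]
          split_ifs <;> omega
        · simp [hci]
    have := h i (x a + 1)
    omega
  · have h1 := hb.1
    have h2 := hb.2.1
    rw [Fin.lt_def] at h1 h2
    split_ifs <;> omega

/-- The tableau criterion; lengths are bounded, so repeatedly climbing from `u` below the ranks of
`x` ends at `x`. -/
theorem le_iff_rank_le {u x : Perm (Fin n)} : LE u x ↔ ∀ i j, rank u i j ≤ rank x i j := by
  refine ⟨fun h i j => h.rank_le i j, fun h => ?_⟩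
  induction hk : Fintype.card (Fin n × Fin n) - length u using Nat.strong_induction_on
    generalizing u with
  | _ k ih =>
    by_cases hne : u = x
    · rw [hne]; exact LE.refl x
    · obtain ⟨u', hu, hu'⟩ := exists_edge_of_rank_le h hne
      refine hu.le.trans (ih _ ?_ hu' rfl)
      have := hu.2
      have := length_le_card u'
      omega

end

/-! ### Moving the largest value: minima of level sets of `pos` and hypercube vertices. -/

section

variable {n m : ℕ}

/-! ### The position of the largest value -/

/-- The position of the largest value. -/
def pos (x : Perm (Fin (m + 1))) : Fin (m + 1) := x⁻¹ (Fin.last m)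

theorem pos_eq_iff {x : Perm (Fin (m + 1))} {a : Fin (m + 1)} : pos x = a ↔ x a = Fin.last m := by
  rw [pos, Perm.inv_eq_iff_eq, eq_comm]

theorem apply_pos (x : Perm (Fin (m + 1))) : x (pos x) = Fin.last m := pos_eq_iff.1 rfl

theorem apply_lt_last {x : Perm (Fin (m + 1))} {c : Fin (m + 1)} (h : c ≠ pos x) :
    x c < Fin.last m :=
  lt_of_le_of_ne (Fin.le_last _) fun hc => h (pos_eq_iff.2 hc).symm

theorem pos_mul_swap (x : Perm (Fin (m + 1))) (a b : Fin (m + 1)) :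
    pos (x * swap a b) = swap a b (pos x) := by
  simp [pos]

theorem Edge.eq_or_of_pos {x y : Perm (Fin (m + 1))} (h : Edge x y) :
    pos y = pos x ∨ (pos y < pos x ∧ y = x * swap (pos y) (pos x)) := by
  obtain ⟨a, b, hab, hx, rfl⟩ := edge_iff.1 h
  rw [pos_mul_swap]
  by_cases ha : pos x = a
  · rw [pos_eq_iff] at ha
    rw [ha] at hx
    exact absurd (Fin.le_last _) (not_le.2 hx)
  · by_cases hb : pos x = b
    · right
      rw [hb, swap_apply_right]
      exact ⟨hab, rfl⟩
    · left
      exact swap_apply_of_ne_of_ne ha hb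

theorem Edge.pos_le {x y : Perm (Fin (m + 1))} (h : Edge x y) : pos y ≤ pos x := by
  rcases h.eq_or_of_pos with h | h
  · exact h.le
  · exact h.1.le

theorem LE.pos_le {x y : Perm (Fin (m + 1))} (h : LE x y) : pos y ≤ pos x := by
  induction h with
  | refl => rfl
  | tail _ h ih => exact h.pos_le.trans ih

theorem rank_le_rank_succ (x : Perm (Fin n)) {i k : ℕ} (h : i ≤ k) (j : ℕ) :
    rank x i j ≤ rank x k j := by
  unfold rank
  refine Finset.sum_le_sum fun c _ => mul_le_mul_of_nonneg_right ?_ (by split_ifs <;> simp)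
  split_ifs <;> omega

/-- A greedy construction: exchange the largest value with the largest value at the positions in
`[a, pos u)`, and repeat until it reaches `a`. Each exchange stays below every `x ≥ u` with `pos x =
a`. -/
theorem exists_minimum_pos (u : Perm (Fin (m + 1))) {a : Fin (m + 1)} (h : a ≤ pos u) :
    ∃ z, pos z = a ∧ LE u z ∧ ∀ x, LE u x → pos x = a → LE z x := by
  induction hk : (pos u).val using Nat.strong_induction_on generalizing u with
  | _ k ih =>
    rcases h.eq_or_lt with h | h
    · exact ⟨u, h.symm, LE.refl u, fun x hx _ => hx⟩
    obtain ⟨c, hc, hmax⟩ := (Finset.Ico a (pos u)).exists_max_image u ⟨a, by simpa using h⟩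
    rw [Finset.mem_Ico] at hc
    have hedge : Edge u (u * swap c (pos u)) :=
      edge_iff.2 ⟨c, pos u, hc.2, by rw [apply_pos]; exact apply_lt_last hc.2.ne, rfl⟩
    have hpos : pos (u * swap c (pos u)) = c := by rw [pos_mul_swap, swap_apply_right]
    obtain ⟨z, hz, huz, hmin⟩ := ih c (by rw [← hk]; exact hc.2) (u * swap c (pos u))
      (by rw [hpos]; exact hc.1) (by rw [hpos])
    refine ⟨z, hz, hedge.le.trans huz, fun x hux hx => hmin x ?_ hx⟩
    rw [le_iff_rank_le]
    intro i j
    have hij := hux.rank_le i j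
    rw [rank_mul_swap u hc.2.ne, apply_pos]
    have hcp := hc.2
    have hac := hc.1
    rw [Fin.lt_def] at hcp
    rw [Fin.le_def] at hac
    -- Only here does the exchange raise the rank. By maximality of `u c`, `u` has no value `≥ j` at
    -- positions in `[a, i)`, whereas `x` has its largest value at `a`, so `x` has rank to spare.
    by_cases hcase : (c.val < i ∧ ¬ (pos u).val < i) ∧ j ≤ m ∧ ¬ j ≤ (u c).val
    · obtain ⟨⟨h1, h2⟩, h3, h4⟩ := hcase
      have e1 : rank u i j = rank u a j := by
        unfold rank
        refine Finset.sum_congr rfl fun d _ => ?_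
        by_cases hda : d.val < a.val
        · simp [hda, show d.val < i by omega]
        · by_cases hdi : d.val < i
          · have h5 := hmax d (by rw [Finset.mem_Ico, Fin.le_def, Fin.lt_def]; omega)
            rw [Fin.le_def] at h5
            have h6 : ¬ j ≤ (u d).val := by omega
            simp [h6]
          · simp [hda, hdi]
      have e2 := hux.rank_le a j
      have e3 := rank_succ x a j
      rw [pos_eq_iff.1 hx] at e3
      have e4 := rank_le_rank_succ x (show a.val + 1 ≤ i by omega) j
      simp only [Fin.val_last, h3, if_true] at e3
      simp only [h1, h2, h3, h4, Fin.val_last, if_true, if_false]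
      omega
    · have h5 := Fin.le_last (u c)
      rw [Fin.le_def] at h5
      simp only [Fin.val_last] at h5 ⊢
      split_ifs <;> omega

/-! ### The vertices of the standard hypercubes -/

/-- Starting with `p`, the value at position `a` moves to the last position in `B`, and the values
at the positions in `B` move to the previous position in `B ∪ {a}`. -/
def shift (a : Fin n) (p : Perm (Fin n)) (B : Finset (Fin n)) : Perm (Fin n) :=
  (B.sort (· ≤ ·)).foldr (fun e x => x * swap a e) p

@[simp]
theorem shift_empty (a : Fin n) (p : Perm (Fin n)) : shift a p ∅ = p := by
  simp [shift]

theorem shift_insert {a : Fin n} {p : Perm (Fin n)} {e : Fin n} {B : Finset (Fin n)}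
    (h : ∀ b ∈ B, e < b) : shift a p (insert e B) = shift a p B * swap a e := by
  rw [shift, Finset.sort_insert (h₁ := fun b hb => (h b hb).le) (h₂ := fun he => (h e he).false)]
  rfl

@[simp]
theorem shift_singleton (a : Fin n) (p : Perm (Fin n)) (e : Fin n) :
    shift a p {e} = p * swap a e := by
  simp [shift]

theorem shift_apply_of_notMem {a : Fin n} (p : Perm (Fin n)) {B : Finset (Fin n)} {c : Fin n}
    (hca : c ≠ a) (hc : c ∉ B) : shift a p B c = p c := by
  induction B using Finset.induction_on_min with
  | empty => simp
  | insert e B he ih =>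
    rw [Finset.mem_insert, not_or] at hc
    rw [shift_insert he, Perm.mul_apply, swap_apply_of_ne_of_ne hca hc.1, ih hc.2]

/-- `B` is a set of positions after `a` on which `p` increases, but remains below `p a`. -/
structure IsRising (a : Fin n) (p : Perm (Fin n)) (B : Finset (Fin n)) : Prop where
  lt : ∀ b ∈ B, a < b
  apply_lt : ∀ b ∈ B, p b < p a
  mono : StrictMonoOn p B

theorem IsRising.subset {a : Fin n} {p : Perm (Fin n)} {B C : Finset (Fin n)}
    (h : IsRising a p B) (hC : C ⊆ B) : IsRising a p C :=
  ⟨fun b hb => h.lt b (hC hb), fun b hb => h.apply_lt b (hC hb), h.mono.mono (by simpa using hC)⟩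

theorem IsRising.lt_shift_apply_self {a : Fin n} {p : Perm (Fin n)} {e : Fin n}
    {B : Finset (Fin n)} (h : IsRising a p (insert e B)) (he : ∀ b ∈ B, e < b) :
    p e < shift a p B a := by
  induction B using Finset.induction_on_min with
  | empty => simpa using h.apply_lt e (by simp)
  | insert f B hf ih =>
    rw [shift_insert hf, Perm.mul_apply, swap_apply_left,
      shift_apply_of_notMem p (h.lt f (by simp)).ne' fun hh => (hf f hh).false]
    exact h.mono (by simp) (by simp) (he f (by simp))

theorem IsRising.lt_shift_apply {a : Fin n} {p : Perm (Fin n)} {B : Finset (Fin n)}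
    (h : IsRising a p B) {c : Fin n} (hc : c ∈ B) : p c < shift a p B c := by
  induction B using Finset.induction_on_min with
  | empty => simp at hc
  | insert e B he ih =>
    rw [shift_insert he, Perm.mul_apply]
    by_cases hce : c = e
    · subst hce
      rw [swap_apply_right]
      exact h.lt_shift_apply_self he
    · rw [swap_apply_of_ne_of_ne (h.lt c hc).ne' hce]
      exact ih (h.subset (Finset.subset_insert _ _)) (Finset.mem_of_mem_insert_of_ne hc hce)

/-- The set is recovered as the positions other than `a` where the shifted permutation exceeds `p`.
-/
theorem shift_injective {a : Fin n} {p : Perm (Fin n)} {B C : Finset (Fin n)}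
    (hB : IsRising a p B) (hC : IsRising a p C) (h : shift a p B = shift a p C) : B = C := by
  ext c
  constructor
  · intro hc
    by_contra hc'
    have := hB.lt_shift_apply hc
    rw [h, shift_apply_of_notMem p (hB.lt c hc).ne' hc'] at this
    exact this.false
  · intro hc
    by_contra hc'
    have := hC.lt_shift_apply hc
    rw [← h, shift_apply_of_notMem p (hC.lt c hc).ne' hc'] at this
    exact this.false

theorem swap_mul_swap_comm {a b c d : Fin n} (h1 : a ≠ c) (h2 : a ≠ d) (h3 : b ≠ c) (h4 : b ≠ d) :
    swap a b * swap c d = swap c d * swap a b := by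
  rw [mul_swap_eq_swap_mul, swap_apply_of_ne_of_ne h1.symm h3.symm,
    swap_apply_of_ne_of_ne h2.symm h4.symm]

/-- The witness `d` is the predecessor of `c` in `B ∪ {a}`. Dropping `c` from the cycle is one
transposition, so the shifts form a cube in the Bruhat graph. -/
theorem IsRising.shift_erase {a : Fin n} {p : Perm (Fin n)} {B : Finset (Fin n)}
    (h : IsRising a p B) {c : Fin n} (hc : c ∈ B) :
    ∃ d, d < c ∧ (d = a ∨ d ∈ B) ∧ shift a p B d < shift a p B c ∧
      shift a p (B.erase c) = shift a p B * swap d c := by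
  induction B using Finset.induction_on_min with
  | empty => simp at hc
  | insert e B he ih =>
    have heB : e ∉ B := fun hh => (he e hh).false
    have hae : a < e := h.lt e (by simp)
    by_cases hce : c = e
    · subst hce
      refine ⟨a, hae, Or.inl rfl, ?_, ?_⟩
      · rw [shift_insert he, Perm.mul_apply, Perm.mul_apply, swap_apply_left, swap_apply_right,
          shift_apply_of_notMem p hae.ne' heB]
        exact h.lt_shift_apply_self he
      · rw [Finset.erase_insert heB, shift_insert he, mul_assoc, swap_mul_self, mul_one]
    · have hcB := Finset.mem_of_mem_insert_of_ne hc hce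
      have hac : a < c := h.lt c hc
      obtain ⟨d, hdc, hd, hlt, heq⟩ := ih (h.subset (Finset.subset_insert _ _)) hcB
      rw [Finset.erase_insert_of_ne (Ne.symm hce), shift_insert he,
        shift_insert fun b hb => he b (Finset.mem_of_mem_erase hb), heq]
      by_cases hda : d = a
      · subst hda
        refine ⟨e, he c hcB, by simp, ?_, ?_⟩
        · simpa [swap_apply_of_ne_of_ne hac.ne' hce] using hlt
        · rw [mul_assoc, mul_assoc, mul_swap_eq_swap_mul (swap d e) e c, swap_apply_right,
            swap_apply_of_ne_of_ne hac.ne' hce]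
      · have hdB : d ∈ B := hd.resolve_left hda
        refine ⟨d, hdc, by simp [hdB], ?_, ?_⟩
        · simpa [swap_apply_of_ne_of_ne hac.ne' hce,
            swap_apply_of_ne_of_ne hda (he d hdB).ne'] using hlt
        · rw [mul_assoc, mul_assoc, swap_mul_swap_comm hda (he d hdB).ne' hac.ne' hce]

theorem IsRising.edge_shift {a : Fin n} {p : Perm (Fin n)} {B : Finset (Fin n)}
    (h : IsRising a p B) {c : Fin n} (hc : c ∈ B) :
    Edge (shift a p B) (shift a p (B.erase c)) := by
  obtain ⟨d, hdc, -, hlt, heq⟩ := h.shift_erase hc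
  exact edge_iff.2 ⟨d, c, hdc, hlt, heq⟩

/-- In a dihedral interval of type `312`, the lower vertex of a diamond is unique. -/
theorem eq_of_edge_of_edge {a e f : Fin n} {p y : Perm (Fin n)} (hae : a < e) (hef : e < f)
    (h1 : p e < p f) (h2 : p f < p a) (he : Edge y (p * swap a e)) (hf : Edge y (p * swap a f)) :
    y = p * swap a f * swap a e := by
  obtain ⟨i, j, hij, hy, h3⟩ := edge_iff.1 he
  obtain ⟨k, l, hkl, hy', h4⟩ := edge_iff.1 hf
  have haf := hae.trans hef
  have hy3 : y = p * swap a e * swap i j := by rw [h3, mul_assoc, swap_mul_self, mul_one]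
  have hy4 : y = p * swap a f * swap k l := by rw [h4, mul_assoc, swap_mul_self, mul_one]
  have hs : swap i j * swap k l = swap a e * swap a f := by
    have : swap a e * swap i j = swap a f * swap k l := by
      rw [hy3, mul_assoc, mul_assoc] at hy4
      exact mul_left_cancel hy4
    calc swap i j * swap k l = swap a e * (swap a e * swap i j) * swap k l := by
          rw [← mul_assoc (swap a e), swap_mul_self, one_mul]
      _ = _ := by rw [this, mul_assoc, mul_assoc, swap_mul_self, mul_one]
  have hkey : ∀ w, swap i j w = w → swap a f (swap a e w) ≠ w →
      swap k l = swap w (swap a f (swap a e w)) := by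
    intro w hw hne
    have h5 : swap k l w = swap a f (swap a e w) := by
      have h6 : swap k l = swap i j * (swap a e * swap a f) := by
        rw [← hs, ← mul_assoc, swap_mul_self, one_mul]
      have h7 : swap k l = (swap a f * swap a e) * swap i j := by
        rw [← swap_inv, h6]; simp [mul_assoc]
      rw [h7, Perm.mul_apply, hw, Perm.mul_apply]
    have h8 : swap k l w ≠ w := h5 ▸ hne
    rw [← h5]
    rcases swap_apply_ne_self_iff.1 h8 with ⟨hkl', rfl | rfl⟩
    · rw [swap_apply_left]
    · rw [swap_apply_right, swap_comm]
  -- A transposition cannot move three points. The fixed one determines `swap k l` from the 3-cycle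
  -- `hs`; for `e` or `f` the edge from `y` would go down.
  have hw : swap i j a = a ∨ swap i j e = e ∨ swap i j f = f := by
    by_contra! H
    obtain ⟨ha, hb, hc⟩ := H
    have ha := (swap_apply_ne_self_iff.1 ha).2
    have hb := (swap_apply_ne_self_iff.1 hb).2
    have hc := (swap_apply_ne_self_iff.1 hc).2
    grind
  have key : ∀ {s t : Fin n}, s < t → swap k l = swap s t → y s < y t := by
    intro s t hst h
    have := hf
    rw [h4, h] at this
    exact (edge_mul_swap_iff hst).1 this
  rcases hw with hw | hw | hw
  · have := hkey a hw (by
      rw [swap_apply_left, swap_apply_of_ne_of_ne hae.ne' hef.ne]; exact hae.ne')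
    rw [swap_apply_left, swap_apply_of_ne_of_ne hae.ne' hef.ne] at this
    rw [hy4, this]
  · have := hkey e hw (by simp [hef.ne'])
    simp only [swap_apply_right, swap_apply_left] at this
    have hlt := key hef this
    rw [hy4, this] at hlt
    simp [swap_apply_of_ne_of_ne hae.ne' hef.ne] at hlt
    exact absurd (h1.trans h2) hlt.asymm
  · have := hkey f hw (by simp [swap_apply_of_ne_of_ne haf.ne' hef.ne', haf.ne])
    rw [swap_apply_of_ne_of_ne haf.ne' hef.ne', swap_apply_right, swap_comm f a] at this
    have hlt := key haf this
    rw [hy4, this] at hlt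
    simp at hlt
    exact absurd h2 hlt.asymm

end

/-! ### Standard decompositions are amazing. -/

section

variable {n m : ℕ}

/-! ### Hypercubes -/

/-- `SpansHypercube` for an indexed family of sources of edges with target `p`. -/
def SpansHypercubeFamily {ι : Type*} (p : Perm (Fin n)) (a : ι → Perm (Fin n)) : Prop :=
  ∃! θ : Set ι → Perm (Fin n), (Function.Injective θ ∧
    ∀ A i, i ∉ A → Edge (θ A) (θ (insert i A))) ∧ θ Set.univ = p ∧ ∀ i, θ (Set.univ \ {i}) = a i

theorem SpansHypercubeFamily.spansHypercube {p : Perm (Fin n)} {E : Set (Perm (Fin n))}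
    (h : SpansHypercubeFamily p (Subtype.val : E → Perm (Fin n))) : SpansHypercube p E := by
  obtain ⟨θ, ⟨⟨hinj, hedge⟩, h1, h2⟩, huniq⟩ := h
  refine ⟨θ, ⟨⟨hinj, ?_⟩, h1, h2⟩, ?_⟩
  · rintro A _ ⟨i, hi, rfl⟩
    exact hedge A i hi
  · rintro θ' ⟨⟨hinj', hedge'⟩, h1', h2'⟩
    exact huniq θ' ⟨⟨hinj', fun A i hi => hedge' A _ ⟨i, hi, rfl⟩⟩, h1', h2'⟩

/-- The vertex `A` goes to the shift of `p` along the positions of the complement of `A`. For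
uniqueness, go down the cube: a vertex missing at least two indices lies below two vertices already
determined, and the diamond lemma `eq_of_edge_of_edge` fixes it. -/
theorem IsRising.spansHypercubeFamily {ι : Type*} [Finite ι] {a : Fin n} {p : Perm (Fin n)}
    {c : ι → Fin n} (hc : Function.Injective c) (h : ∀ s : Finset ι, IsRising a p (s.image c)) :
    SpansHypercubeFamily p fun i => p * swap a (c i) := by
  classical
  cases nonempty_fintype ι
  let F : Set ι → Finset ι := fun A => Finset.univ.filter (· ∉ A)
  have hF : ∀ A i, i ∈ F A ↔ i ∉ A := fun A i => by simp [F]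
  have hFins : ∀ A i, F (insert i A) = (F A).erase i := by
    intro A i; ext j
    rw [hF, Finset.mem_erase, hF, Set.mem_insert_iff, not_or]
  have hFinj : Function.Injective F := by
    intro A B hAB
    ext i
    rw [← not_iff_not, ← hF, ← hF, hAB]
  have him : ∀ (s : Finset ι) i, (s.erase i).image c = (s.image c).erase (c i) := fun s i =>
    Finset.image_erase hc s i
  have hFu : F Set.univ = ∅ := by ext; simp [hF]
  have hFs : ∀ i, F (Set.univ \ {i}) = {i} := by intro i; ext; simp [hF]
  refine ⟨fun A => shift a p ((F A).image c), ⟨⟨?_, ?_⟩, ?_, ?_⟩, ?_⟩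
  · intro A B hAB
    exact hFinj (Finset.image_injective hc (shift_injective (h _) (h _) hAB))
  · intro A i hi
    simp only [hFins, him]
    exact (h _).edge_shift (Finset.mem_image_of_mem c ((hF A i).2 hi))
  · simp [hFu]
  · intro i
    simp [hFs]
  · rintro θ ⟨⟨-, hedge⟩, h1, h2⟩
    funext A
    induction hk : (F A).card using Nat.strong_induction_on generalizing A with
    | _ k ih =>
      by_cases hk0 : (F A).Nonempty
      swap
      · rw [Finset.not_nonempty_iff_eq_empty, ← hFu] at hk0
        rw [hFinj hk0, h1, hFu]
        simp
      obtain ⟨i, hi, himin⟩ := (F A).exists_min_image c hk0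
      by_cases hk1 : ((F A).erase i).Nonempty
      swap
      · have : F A = {i} := by
          rw [Finset.not_nonempty_iff_eq_empty] at hk1
          rw [← Finset.insert_erase hi, hk1]
          rfl
        rw [← hFs i] at this
        rw [hFinj this, h2, hFs]
        simp
      -- The two smallest missing positions are used, since `shift_insert` adds a new smallest
      -- position; the top of the diamond is the shift along the rest.
      obtain ⟨j, hj, hjmin⟩ := ((F A).erase i).exists_min_image c hk1
      have hj' := Finset.mem_erase.1 hj
      have hij : c i < c j := lt_of_le_of_ne (himin j hj'.2) fun hh => hj'.1 (hc hh).symm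
      set s := ((F A).erase i).erase j with hs
      have hjs : ∀ b ∈ s.image c, c j < b := by
        intro b hb
        obtain ⟨l, hl, rfl⟩ := Finset.mem_image.1 hb
        rw [hs, Finset.mem_erase] at hl
        exact lt_of_le_of_ne (hjmin l hl.2) fun hh => hl.1 (hc hh).symm
      have his : ∀ b ∈ s.image c, c i < b := fun b hb => hij.trans (hjs b hb)
      have hAi : (F A).erase i = insert j s := (Finset.insert_erase hj).symm
      have hAj : (F A).erase j = insert i s := by
        rw [hs, Finset.erase_right_comm, Finset.insert_erase]
        exact Finset.mem_erase.2 ⟨hj'.1.symm, hi⟩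
      have hA : F A = insert i (insert j s) := by rw [← hAi, Finset.insert_erase hi]
      have ei := hedge A i ((hF A i).1 hi)
      have ej := hedge A j ((hF A j).1 hj'.2)
      rw [ih _ (by rw [← hk]; exact Finset.card_erase_lt_of_mem hi) (insert i A) (by rw [hFins]),
        hFins, hAi, Finset.image_insert, shift_insert hjs] at ei
      rw [ih _ (by rw [← hk]; exact Finset.card_erase_lt_of_mem hj'.2) (insert j A) (by rw [hFins]),
        hFins, hAj, Finset.image_insert, shift_insert his] at ej
      have hall := h (insert i (insert j s))
      rw [Finset.image_insert, Finset.image_insert] at hall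
      have hai := hall.lt (c i) (by simp)
      have haj := hall.lt (c j) (by simp)
      have hsi : c i ∉ s.image c := fun hh => (his _ hh).false
      have hsj : c j ∉ s.image c := fun hh => (hjs _ hh).false
      have := eq_of_edge_of_edge hai hij (p := shift a p (s.image c)) ?_ ?_ ej ei
      · rw [this, hA, Finset.image_insert, Finset.image_insert, shift_insert, shift_insert hjs]
        intro b hb
        rcases Finset.mem_insert.1 hb with rfl | hb
        · exact hij
        · exact his b hb
      · rw [shift_apply_of_notMem p hai.ne' hsi, shift_apply_of_notMem p haj.ne' hsj]
        exact hall.mono (by simp) (by simp) hij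
      · rw [shift_apply_of_notMem p haj.ne' hsj]
        exact (hall.subset (Finset.subset_insert _ _)).lt_shift_apply_self hjs

/-! ### Automorphisms of the Bruhat graph -/

/-- `φ` is an automorphism of the Bruhat graph. -/
structure IsAut (φ : Perm (Fin n) ≃ Perm (Fin n)) : Prop where
  edge_iff : ∀ {x y}, Edge (φ x) (φ y) ↔ Edge x y

theorem IsAut.symm {φ : Perm (Fin n) ≃ Perm (Fin n)} (h : IsAut φ) : IsAut φ.symm :=
  ⟨fun {x y} => by rw [← h.edge_iff, φ.apply_symm_apply, φ.apply_symm_apply]⟩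

theorem IsAut.map_le {φ : Perm (Fin n) ≃ Perm (Fin n)} (h : IsAut φ) {x y : Perm (Fin n)}
    (hxy : LE x y) : LE (φ x) (φ y) := by
  induction hxy with
  | refl => exact LE.refl _
  | tail _ hbc ih => exact ih.trans (h.edge_iff.2 hbc).le

theorem IsAut.le_iff {φ : Perm (Fin n) ≃ Perm (Fin n)} (h : IsAut φ) {x y : Perm (Fin n)} :
    LE (φ x) (φ y) ↔ LE x y :=
  ⟨fun hxy => by simpa using h.symm.map_le hxy, h.map_le⟩

theorem IsAut.spansHypercubeFamily {φ : Perm (Fin n) ≃ Perm (Fin n)} (hφ : IsAut φ) {ι : Type*}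
    {p : Perm (Fin n)} {a : ι → Perm (Fin n)} (h : SpansHypercubeFamily (φ p) (fun i => φ (a i))) :
    SpansHypercubeFamily p a := by
  obtain ⟨θ, ⟨⟨hinj, hedge⟩, h1, h2⟩, huniq⟩ := h
  refine ⟨fun A => φ.symm (θ A), ⟨⟨φ.symm.injective.comp hinj, fun A i hi => ?_⟩, ?_, ?_⟩, ?_⟩
  · exact hφ.symm.edge_iff.2 (hedge A i hi)
  · simp [h1]
  · simp [h2]
  · rintro θ' ⟨⟨hinj', hedge'⟩, h1', h2'⟩
    have := huniq (fun A => φ (θ' A)) ⟨⟨φ.injective.comp hinj', fun A i hi =>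
      hφ.edge_iff.2 (hedge' A i hi)⟩, by simp [h1'], by simp [h2']⟩
    funext A
    rw [← this, φ.symm_apply_apply]

/-! ### The standard hypercube decompositions -/

variable {φ : Perm (Fin (m + 1)) ≃ Perm (Fin (m + 1))} {u v z x y p : Perm (Fin (m + 1))}

theorem IsAut.pos_le (hφ : IsAut φ) (h : LE x y) : pos (φ y) ≤ pos (φ x) := (hφ.map_le h).pos_le

/-- The minimum of all the elements of `[u, v]` that have, up to the automorphism `φ` of the Bruhat
graph, their largest value at the same position as `v`. -/
def IsStandard (φ : Perm (Fin (m + 1)) ≃ Perm (Fin (m + 1))) (u v z : Perm (Fin (m + 1))) : Prop :=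
  IsMinimum (interval u v ∩ {x | pos (φ x) = pos (φ v)}) z

theorem exists_isStandard (hφ : IsAut φ) (huv : LE u v) : ∃ z, IsStandard φ u v z := by
  obtain ⟨z, hz, huz, hmin⟩ := exists_minimum_pos (φ u) (hφ.pos_le huv)
  have hmin' : ∀ x, LE u x → pos (φ x) = pos (φ v) → LE (φ.symm z) x := fun x hx hpx => by
    simpa using hφ.symm.map_le (hmin _ (hφ.map_le hx) hpx)
  refine ⟨φ.symm z, ⟨⟨?_, hmin' v huv rfl⟩, by simpa using hz⟩, ?_⟩
  · simpa using hφ.symm.map_le huz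
  · rintro x ⟨hx, hpx⟩
    exact hmin' x hx.1 hpx

/-- The position decreases weakly along the Bruhat order and agrees at `z` and `v`, hence is
constant in between. -/
theorem IsStandard.mem_interval_iff (hφ : IsAut φ) (hz : IsStandard φ u v z) :
    y ∈ interval z v ↔ y ∈ interval u v ∧ pos (φ y) = pos (φ v) := by
  constructor
  · rintro ⟨h1, h2⟩
    refine ⟨⟨hz.1.1.1.trans h1, h2⟩, le_antisymm ?_ (hφ.pos_le h2)⟩
    exact (hφ.pos_le h1).trans (hz.1.2 : pos (φ z) = pos (φ v)).le
  · rintro ⟨h1, h2⟩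
    exact ⟨hz.2 y ⟨h1, h2⟩, h1.2⟩

theorem IsAut.eq_mul_swap (hφ : IsAut φ) (h : Edge x y) (hne : pos (φ x) ≠ pos (φ y)) :
    pos (φ y) < pos (φ x) ∧ φ x = φ y * swap (pos (φ y)) (pos (φ x)) := by
  rcases (hφ.edge_iff.2 h).eq_or_of_pos with h | ⟨h, h'⟩
  · exact absurd h.symm hne
  · refine ⟨h, ?_⟩
    exact (mul_inv_eq_iff_eq_mul.2 h').symm.trans (by rw [swap_inv])

/-- Moving the largest value to different positions yields comparable elements if the values at
these positions are inverted. -/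
theorem le_of_inversion {p : Perm (Fin (m + 1))} {c d : Fin (m + 1)} (hc : pos p < c) (hcd : c < d)
    (h : p d < p c) : LE (p * swap (pos p) d) (p * swap (pos p) c) := by
  have hd := hc.trans hcd
  have e1 : Edge (p * swap (pos p) d) (p * swap (pos p) d * swap c d) := by
    refine (edge_mul_swap_iff hcd).2 ?_
    simp only [Perm.mul_apply, swap_apply_of_ne_of_ne hc.ne' hcd.ne, swap_apply_right, apply_pos]
    exact apply_lt_last hc.ne'
  have e2 : Edge (p * swap (pos p) d * swap c d)
      (p * swap (pos p) d * swap c d * swap (pos p) d) := by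
    refine (edge_mul_swap_iff hd).2 ?_
    simpa [swap_apply_of_ne_of_ne hc.ne hd.ne, swap_apply_of_ne_of_ne hc.ne' hcd.ne] using h
  have e3 : p * swap (pos p) d * swap c d * swap (pos p) d = p * swap (pos p) c := by
    rw [mul_assoc p, mul_assoc p, swap_comm (pos p) d, swap_mul_swap_mul_swap hcd.ne hc.ne']
  exact e1.le.trans (e3 ▸ e2.le)

theorem IsStandard.isHypercubeDecomposition (hφ : IsAut φ) (hz : IsStandard φ u v z) :
    IsHypercubeDecomposition u v z where
  mem := hz.1.1
  diamond := by
    intro x hx a₁ h₁ a₂ h₂ y hy hne e₁ _ e₂ _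
    rw [hz.mem_interval_iff hφ] at h₁ h₂ ⊢
    refine ⟨hx, ?_⟩
    by_contra hpx
    -- From an `x` outside, an edge into `[z, v]` must bring the largest value to the position it
    -- has in `v`; this determines the target.
    have h3 := (hφ.eq_mul_swap e₁ (by rwa [h₁.2])).2
    have h4 := (hφ.eq_mul_swap e₂ (by rwa [h₂.2])).2
    rw [h₁.2] at h3
    rw [h₂.2] at h4
    exact hne (φ.injective (mul_right_cancel (h3.symm.trans h4)))
  cluster := by
    intro p hp E hE hanti
    rw [hz.mem_interval_iff hφ] at hp
    have key : ∀ x ∈ E, pos (φ p) < pos (φ x) ∧ φ x = φ p * swap (pos (φ p)) (pos (φ x)) := by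
      intro x hx
      obtain ⟨⟨h1, h2⟩, h3⟩ := hE hx
      refine hφ.eq_mul_swap h3 fun h => h2 ?_
      rw [hz.mem_interval_iff hφ]
      exact ⟨h1, h.trans hp.2⟩
    apply SpansHypercubeFamily.spansHypercube
    apply hφ.spansHypercubeFamily
    have heq : (fun i : E => φ i) = fun i : E => φ p * swap (pos (φ p)) (pos (φ i)) := by
      funext i
      exact (key i i.2).2
    rw [heq]
    refine IsRising.spansHypercubeFamily (c := fun i : E => pos (φ i)) ?_ ?_
    · intro i j hij
      apply Subtype.ext
      apply φ.injective
      rw [(key i i.2).2, (key j j.2).2]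
      exact congrArg _ (congrArg _ hij)
    · intro s
      refine ⟨?_, ?_, ?_⟩
      · intro b hb
        obtain ⟨i, -, rfl⟩ := Finset.mem_image.1 hb
        exact (key i i.2).1
      · intro b hb
        obtain ⟨i, -, rfl⟩ := Finset.mem_image.1 hb
        rw [apply_pos]
        exact apply_lt_last (key i i.2).1.ne'
      · intro b hb c hc hbc
        obtain ⟨i, -, rfl⟩ := Finset.mem_image.1 (Finset.mem_coe.1 hb)
        obtain ⟨j, -, rfl⟩ := Finset.mem_image.1 (Finset.mem_coe.1 hc)
        -- An inversion of `φ p` at two of these positions would make the two sources comparable.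
        by_contra hlt
        have hlt' := lt_of_le_of_ne (not_lt.1 hlt) fun h => hbc.ne' ((φ p).injective h)
        have := le_of_inversion (key i i.2).1 hbc hlt'
        rw [← (key i i.2).2, ← (key j j.2).2, hφ.le_iff] at this
        exact hanti j j.2 i i.2 (fun h => hbc.ne (by rw [h])) this

/-- The position condition refers only to `v`, so it also cuts `[z, v] ∩ [x, v]` out of `[x, v]`:
joins are standard for the shorter interval. -/
theorem IsStandard.isJoin_iff (hφ : IsAut φ) (hz : IsStandard φ u v z) (hx : x ∈ interval u v)
    {w : Perm (Fin (m + 1))} : IsJoin v z x w ↔ IsStandard φ x v w := by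
  have : interval z v ∩ interval x v = interval x v ∩ {y | pos (φ y) = pos (φ v)} := by
    ext y
    rw [Set.mem_inter_iff, hz.mem_interval_iff hφ]
    constructor
    · rintro ⟨⟨-, h⟩, h'⟩
      exact ⟨h', h⟩
    · rintro ⟨h', h⟩
      exact ⟨⟨⟨hx.1.trans h'.1, h'.2⟩, h⟩, h'⟩
  rw [IsJoin, this]
  rfl

theorem IsStandard.isAmazing (hφ : IsAut φ) (hz : IsStandard φ u v z) : IsAmazing u v z where
  isHypercubeDecomposition := hz.isHypercubeDecomposition hφ
  join := by
    intro x hx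
    obtain ⟨w, hw⟩ := exists_isStandard hφ hx.2
    exact ⟨w, (hz.isJoin_iff hφ hx).2 hw, hw.isHypercubeDecomposition hφ⟩

end

/-! ### Distances and the description of shortcuts. -/

section

variable {n m : ℕ}

/-! ### Walks and distances -/

/-- There is a path of length `k` from `x` to `y`. -/
def Walk : ℕ → Perm (Fin n) → Perm (Fin n) → Prop
  | 0, x, y => x = y
  | k + 1, x, y => ∃ w, Walk k x w ∧ Edge w y

theorem Walk.append {j k : ℕ} {x y z : Perm (Fin n)} (h : Walk j x y) (h' : Walk k y z) :
    Walk (j + k) x z := by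
  induction k generalizing z with
  | zero => obtain rfl : y = z := h'; exact h
  | succ k ih =>
    obtain ⟨w, hw, hwz⟩ := h'
    exact ⟨w, ih hw, hwz⟩

theorem Walk.snoc {k : ℕ} {x y z : Perm (Fin n)} (h : Walk k x y) (h' : Edge y z) :
    Walk (k + 1) x z := ⟨y, h, h'⟩

theorem Walk.le {k : ℕ} {x y : Perm (Fin n)} (h : Walk k x y) : LE x y := by
  induction k generalizing y with
  | zero => obtain rfl : x = y := h; exact LE.refl x
  | succ k ih =>
    obtain ⟨w, hw, hwz⟩ := h
    exact (ih hw).trans hwz.le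

theorem LE.exists_walk {x y : Perm (Fin n)} (h : LE x y) : ∃ k, Walk k x y := by
  induction h with
  | refl => exact ⟨0, rfl⟩
  | tail _ h ih =>
    obtain ⟨k, hk⟩ := ih
    exact ⟨k + 1, hk.snoc h⟩

theorem walk_of_path (Γ : BruhatPath n) (i : ℕ) (hi : i < Γ.length + 1) (k : ℕ)
    (hk : i + k < Γ.length + 1) : Walk k (Γ ⟨i, hi⟩) (Γ ⟨i + k, hk⟩) := by
  induction k with
  | zero => rfl
  | succ k ih => exact (ih (by omega)).snoc (Γ.step ⟨i + k, by omega⟩)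

theorem Walk.exists_path {j k : ℕ} {x y z : Perm (Fin n)} (h : Walk j x y) (h' : Walk k y z) :
    ∃ Γ : BruhatPath n, IsPath x z Γ ∧ Γ.length = j + k ∧ y ∈ Set.range Γ.toFun := by
  induction k generalizing z with
  | zero =>
    obtain rfl : y = z := h'
    induction j generalizing y with
    | zero =>
      obtain rfl : x = y := h
      exact ⟨RelSeries.singleton _ x, ⟨rfl, rfl⟩, rfl, ⟨0, rfl⟩⟩
    | succ j ih =>
      obtain ⟨w, hw, hwy⟩ := h
      obtain ⟨Γ, ⟨h1, h2⟩, h3, -⟩ := ih hw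
      have hrel : Γ.last = w := h2
      refine ⟨Γ.snoc y (hrel ▸ hwy), ⟨by simpa using h1, by simp⟩, ?_, ?_⟩
      · change Γ.length + 1 + 0 = _; omega
      · exact RelSeries.mem_snoc.2 (Or.inr rfl)
  | succ k ih =>
    obtain ⟨w, hw, hwz⟩ := h'
    obtain ⟨Γ, ⟨h1, h2⟩, h3, h4⟩ := ih hw
    have hrel : Γ.last = w := h2
    refine ⟨Γ.snoc z (hrel ▸ hwz), ⟨by simpa using h1, by simp⟩, ?_, ?_⟩
    · change Γ.length + 1 + 0 = _; omega
    · exact RelSeries.mem_snoc.2 (Or.inl h4)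

theorem exists_path_iff {x y : Perm (Fin n)} {k : ℕ} :
    (∃ Γ : BruhatPath n, IsPath x y Γ ∧ Γ.length = k) ↔ Walk k x y := by
  constructor
  · rintro ⟨Γ, ⟨rfl, rfl⟩, rfl⟩
    have := walk_of_path Γ 0 (by omega) Γ.length (by omega)
    simpa [RelSeries.head, RelSeries.last, Fin.last] using this
  · intro h
    obtain ⟨Γ, h1, h2, -⟩ := Walk.exists_path (k := 0) h rfl
    exact ⟨Γ, h1, h2⟩

theorem dist_le {x y : Perm (Fin n)} {k : ℕ} (h : Walk k x y) : dist x y ≤ k :=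
  Nat.sInf_le (exists_path_iff.2 h)

theorem LE.walk_dist {x y : Perm (Fin n)} (h : LE x y) : Walk (dist x y) x y := by
  obtain ⟨k, hk⟩ := h.exists_walk
  exact exists_path_iff.1 (Nat.sInf_mem (s := {r | ∃ Γ : BruhatPath n, IsPath x y Γ ∧ Γ.length = r})
    ⟨k, exists_path_iff.2 hk⟩)

theorem mem_shortcuts_iff_walk {u v z p : Perm (Fin n)} (huz : LE u z) :
    p ∈ shortcuts u v z ↔ p ∈ interval z v ∧ ∀ q ∈ interval z v, ∀ j k, Walk j u q → Walk k q p →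
      j + k = dist u p → q = p := by
  refine and_congr_right fun hp => ⟨fun h q hq j k hj hk hjk => ?_, fun h Γ hΓ hl => ?_⟩
  · obtain ⟨Γ, h1, h2, h3⟩ := hj.exists_path hk
    have : q ∈ Set.range Γ.toFun ∩ interval z v := ⟨h3, hq⟩
    rwa [h Γ h1 (h2.trans hjk)] at this
  · obtain ⟨rfl, rfl⟩ := hΓ
    refine Set.Subset.antisymm ?_ ?_
    · rintro _ ⟨⟨i, rfl⟩, hi⟩
      have h1 := walk_of_path Γ 0 (by omega) i (by omega)
      have h2 := walk_of_path Γ i (by omega) (Γ.length - i) (by omega)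
      have e : (⟨i + (Γ.length - i), by omega⟩ : Fin (Γ.length + 1)) = Fin.last _ := by
        ext; simp; omega
      rw [e] at h2
      simp only [zero_add] at h1
      exact h _ hi i (Γ.length - i) h1 h2 (by rw [← hl]; omega)
    · rintro _ rfl
      exact ⟨⟨_, rfl⟩, hp⟩

theorem IsAut.map_walk {φ : Perm (Fin n) ≃ Perm (Fin n)} (hφ : IsAut φ) {k : ℕ}
    {x y : Perm (Fin n)} (h : Walk k x y) : Walk k (φ x) (φ y) := by
  induction k generalizing y with
  | zero => exact congrArg φ h
  | succ k ih =>
    obtain ⟨w, hw, hwz⟩ := h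
    exact (ih hw).snoc (hφ.edge_iff.2 hwz)

theorem IsAut.walk_iff {φ : Perm (Fin n) ≃ Perm (Fin n)} (hφ : IsAut φ) {k : ℕ}
    {x y : Perm (Fin n)} : Walk k (φ x) (φ y) ↔ Walk k x y :=
  ⟨fun h => by simpa using hφ.symm.map_walk h, hφ.map_walk⟩

theorem IsAut.dist_eq {φ : Perm (Fin n) ≃ Perm (Fin n)} (hφ : IsAut φ) (x y : Perm (Fin n)) :
    dist (φ x) (φ y) = dist x y := by
  simp only [dist, exists_path_iff, hφ.walk_iff]

/-! ### A lower bound for the distance -/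

/-- Merging the labels of `i` and `j` loses at most one label. This is the bound of reflection
length by cycle counting, with labels in place of cycles. -/
theorem exists_label_mul_swap {k : ℕ} {x y : Perm (Fin n)} (i j : Fin n)
    (h : ∃ f : Fin n → Fin n, n ≤ k + (Finset.univ.image f).card ∧ ∀ c, f (x⁻¹ (y c)) = f c) :
    ∃ f : Fin n → Fin n, n ≤ k + 1 + (Finset.univ.image f).card ∧ f i = f j ∧
      ∀ c, f (x⁻¹ ((y * swap i j) c)) = f c := by
  obtain ⟨f, hf, hf'⟩ := h
  refine ⟨fun c => if f c = f i then f j else f c, ?_, by simp, ?_⟩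
  · have : (Finset.univ.image f).erase (f i) ⊆
        Finset.univ.image fun c => if f c = f i then f j else f c := by
      intro c hc
      obtain ⟨hc, hc'⟩ := Finset.mem_erase.1 hc
      obtain ⟨d, -, rfl⟩ := Finset.mem_image.1 hc'
      exact Finset.mem_image.2 ⟨d, Finset.mem_univ _, if_neg hc⟩
    have := Finset.card_le_card this
    have := Finset.pred_card_le_card_erase (s := Finset.univ.image f) (a := f i)
    omega
  · intro c
    simp only [Perm.mul_apply, hf']
    rw [swap_apply_def]
    split_ifs <;> simp_all

/-- A path of length `k` from `x` to `y` has a labelling of the positions by at least `n - k`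
labels that is invariant under `x⁻¹ * y`. -/
theorem Walk.exists_label {k : ℕ} {x y : Perm (Fin n)} (h : Walk k x y) :
    ∃ f : Fin n → Fin n, n ≤ k + (Finset.univ.image f).card ∧ ∀ c, f (x⁻¹ (y c)) = f c := by
  induction k generalizing y with
  | zero =>
    obtain rfl : x = y := h
    exact ⟨id, by simp, by simp⟩
  | succ k ih =>
    obtain ⟨w, hw, hwy⟩ := h
    obtain ⟨i, j, -, -, rfl⟩ := edge_iff.1 hwy
    obtain ⟨f, h1, -, h2⟩ := exists_label_mul_swap i j (ih hw)
    exact ⟨f, h1, h2⟩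

/-- The quotient of `p` and its shift sends each element of `B` to its predecessor in `B ∪ {a}`, so
an invariant labelling is constant there. -/
theorem IsRising.label_eq {a : Fin n} {p : Perm (Fin n)} {B : Finset (Fin n)}
    (h : IsRising a p B) {f : Fin n → Fin n} (hf : ∀ c, f ((shift a p B)⁻¹ (p c)) = f c)
    {b : Fin n} (hb : b ∈ B) : f b = f a := by
  induction b using WellFoundedLT.induction with
  | _ b ih =>
    obtain ⟨d, hdb, hd, -, heq⟩ := h.shift_erase hb
    have h1 : shift a p B d = p b := by
      have := congrArg (fun w : Perm (Fin n) => w b) heq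
      simp only [Perm.mul_apply, swap_apply_right] at this
      rw [← this, shift_apply_of_notMem p (h.lt b hb).ne' (Finset.notMem_erase b B)]
    have h2 := hf b
    rw [← h1, Perm.inv_def, symm_apply_apply] at h2
    rw [← h2]
    rcases hd with rfl | hd
    · rfl
    · exact ih d hdb hd

theorem IsRising.card_le {a : Fin n} {p : Perm (Fin n)} {B : Finset (Fin n)}
    (h : IsRising a p B) {k : ℕ} (hk : Walk k (shift a p B) p) : B.card ≤ k := by
  obtain ⟨f, hf, hf'⟩ := hk.exists_label
  have ha : a ∉ B := fun ha => (h.lt a ha).false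
  have : Finset.univ.image f ⊆ Bᶜ.image f := by
    intro c hc
    obtain ⟨d, -, rfl⟩ := Finset.mem_image.1 hc
    by_cases hd : d ∈ B
    · exact Finset.mem_image.2 ⟨a, by simpa using ha, (h.label_eq hf' hd).symm⟩
    · exact Finset.mem_image.2 ⟨d, by simpa using hd, rfl⟩
  have := (Finset.card_le_card this).trans Finset.card_image_le
  have h3 := Finset.card_add_card_compl B
  rw [Fintype.card_fin] at h3
  omega

/-- On a path of length `|B|` there is no room for an extra merge: if `i` were outside `B ∪ {a}`,
giving it the label of `j` would leave at most `n - |B| - 1` labels, against the required `n - |B|`.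
-/
theorem IsRising.mem_of_last_step {a : Fin n} {p q : Perm (Fin n)} {B : Finset (Fin n)}
    (h : IsRising a p B) {k : ℕ} (hk : Walk k (shift a p B) q) {i j : Fin n} (hij : i ≠ j)
    (hq : q * swap i j = p) (hB : B.card = k + 1) :
    i ∈ insert a B := by
  obtain ⟨f, hf, hfij, hf'⟩ := exists_label_mul_swap i j hk.exists_label
  rw [hq] at hf'
  have ha : a ∉ B := fun ha => (h.lt a ha).false
  by_contra hi
  rw [Finset.mem_insert, not_or] at hi
  have : Finset.univ.image f ⊆ (insert i B)ᶜ.image f := by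
    have key : ∀ d, d ≠ i → f d ∈ (insert i B)ᶜ.image f := by
      intro d hdi
      by_cases hd : d ∈ B
      · exact Finset.mem_image.2 ⟨a, by simp [ha, Ne.symm hi.1], (h.label_eq hf' hd).symm⟩
      · exact Finset.mem_image.2 ⟨d, by simp [hd, hdi], rfl⟩
    intro c hc
    obtain ⟨d, -, rfl⟩ := Finset.mem_image.1 hc
    by_cases hdi : d = i
    · rw [hdi, hfij]
      exact key j hij.symm
    · exact key d hdi
  have := (Finset.card_le_card this).trans Finset.card_image_le
  have h3 := Finset.card_add_card_compl (insert i B)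
  rw [Fintype.card_fin, Finset.card_insert_of_notMem hi.2] at h3
  omega

theorem IsRising.walk {a : Fin n} {p : Perm (Fin n)} {B C : Finset (Fin n)}
    (h : IsRising a p B) (hC : C ⊆ B) : Walk (B \ C).card (shift a p B) (shift a p C) := by
  induction hk : (B \ C).card generalizing C with
  | zero =>
    rw [Finset.card_eq_zero, Finset.sdiff_eq_empty_iff_subset] at hk
    exact congrArg _ (hk.antisymm hC)
  | succ k ih =>
    obtain ⟨c, hc⟩ := Finset.card_pos.1 (by omega : 0 < (B \ C).card)
    have hc' := Finset.mem_sdiff.1 hc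
    have hsub : insert c C ⊆ B := Finset.insert_subset hc'.1 hC
    have := (h.subset hsub).edge_shift (Finset.mem_insert_self c C)
    rw [Finset.erase_insert hc'.2] at this
    refine (ih hsub ?_).snoc this
    rw [Finset.sdiff_insert, Finset.card_erase_of_mem hc, hk]
    rfl

theorem IsRising.dist_eq {a : Fin n} {p : Perm (Fin n)} {B : Finset (Fin n)}
    (h : IsRising a p B) : dist (shift a p B) p = B.card := by
  have hw : Walk B.card (shift a p B) p := by
    have := h.walk (Finset.empty_subset B)
    rwa [Finset.sdiff_empty, shift_empty] at this
  exact le_antisymm (dist_le hw) (h.card_le hw.le.walk_dist)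

/-! ### Shortcuts of standard hypercube decompositions -/

/-- `u` arises from `p` by moving the largest value to the right, through positions at which the
values of `p` increase. -/
def IsShift (u p : Perm (Fin (m + 1))) : Prop :=
  ∃ B, IsRising (pos p) p B ∧ u = shift (pos p) p B

theorem isRising_pos_iff {p : Perm (Fin (m + 1))} {B : Finset (Fin (m + 1))} :
    IsRising (pos p) p B ↔ (∀ b ∈ B, pos p < b) ∧ StrictMonoOn p B := by
  refine ⟨fun h => ⟨h.lt, h.mono⟩, fun h => ⟨h.1, fun b hb => ?_, h.2⟩⟩
  rw [apply_pos]
  exact apply_lt_last (h.1 b hb).ne'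

theorem IsShift.le {u p : Perm (Fin (m + 1))} (h : IsShift u p) : LE u p := by
  obtain ⟨B, hB, rfl⟩ := h
  have := hB.walk (Finset.empty_subset B)
  rw [shift_empty] at this
  exact this.le

/-- The last transposition of a shortest path lies in `B ∪ {pos p}`. If it left the largest value in
place, it would exchange two positions in `B`; going up, it would create an inversion of `p` there,
but `p` increases on `B`. -/
theorem IsShift.pos_ne {u p q : Perm (Fin (m + 1))} (h : IsShift u p) {k : ℕ} (hk : Walk k u q)
    (he : Edge q p) (hd : k + 1 = dist u p) : pos q ≠ pos p := by
  obtain ⟨B, hB, rfl⟩ := h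
  rw [hB.dist_eq] at hd
  obtain ⟨i, j, hij, hq, hp⟩ := edge_iff.1 he
  intro hpos
  have hi := hB.mem_of_last_step hk hij.ne hp.symm hd.symm
  have hj := hB.mem_of_last_step hk hij.ne' (by rw [swap_comm, hp]) hd.symm
  have hne : ∀ c, c = i ∨ c = j → c ≠ pos p := by
    intro c hc hcp
    have h1 := pos_mul_swap q i j
    rw [← hp, hpos, eq_comm, swap_apply_eq_iff, ← hcp] at h1
    rcases hc with rfl | rfl
    · rw [swap_apply_left] at h1; exact hij.ne h1
    · rw [swap_apply_right] at h1; exact hij.ne' h1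
  have hi := Finset.mem_of_mem_insert_of_ne hi (hne i (Or.inl rfl))
  have hj := Finset.mem_of_mem_insert_of_ne hj (hne j (Or.inr rfl))
  have := hB.mono hi hj hij
  rw [hp] at this
  simp only [Perm.mul_apply, swap_apply_left, swap_apply_right] at this
  exact this.asymm hq

theorem shift_mul_swap {a c : Fin n} {q : Perm (Fin n)} {B : Finset (Fin n)} (ha : a ∉ B)
    (hc : c ∉ B) : shift a (q * swap a c) B = shift c q B * swap a c := by
  induction B using Finset.induction_on_min with
  | empty => simp
  | insert e B he ih =>
    rw [Finset.mem_insert, not_or] at ha hc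
    rw [shift_insert he, shift_insert he, ih ha.2 hc.2, mul_assoc, mul_assoc,
      mul_swap_eq_swap_mul (swap a c), swap_apply_left,
      swap_apply_of_ne_of_ne (Ne.symm ha.1) (Ne.symm hc.1)]

/-- A path of length two from `r` whose second step, and only the second one, moves the largest
value can be replaced by another one. -/
theorem exists_flip {r q p : Perm (Fin (m + 1))} (hrq : Edge r q) (hqp : Edge q p)
    (h1 : pos r = pos q) (h2 : pos q ≠ pos p) :
    ∃ q', Edge r q' ∧ Edge q' p ∧ pos q' < pos q := by
  obtain ⟨i, j, hij, hr, hq⟩ := edge_iff.1 hrq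
  obtain ⟨hlt, hp⟩ := (hqp.eq_or_of_pos).resolve_left (Ne.symm h2)
  obtain ⟨a, ha⟩ : ∃ a, a = pos p := ⟨_, rfl⟩
  obtain ⟨c, hc⟩ : ∃ c, c = pos q := ⟨_, rfl⟩
  rw [← ha, ← hc] at hlt hp
  rw [← hc] at h1 ⊢
  have hrc : r c = Fin.last m := pos_eq_iff.1 h1
  have hc' : c ≠ i ∧ c ≠ j := by
    have := pos_mul_swap r i j
    rw [← hq, h1, ← hc] at this
    constructor
    · intro h; rw [h, swap_apply_left] at this; exact hij.ne this
    · intro h; rw [h, swap_apply_right] at this; exact hij.ne' this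
  have hra : r a < r c := by
    rw [hrc]; exact apply_lt_last (by rw [h1]; exact hlt.ne)
  have e1 : Edge r (r * swap a c) := (edge_mul_swap_iff hlt).2 hra
  have p1 : pos (r * swap a c) < c := by rw [pos_mul_swap, h1, swap_apply_right]; exact hlt
  -- The path through `r * swap a c` works unless `i = a` and `j < c`; then `r * swap j c` is used.
  by_cases hia : i = a
  · subst hia
    rcases lt_or_gt_of_ne hc'.2 with h | h
    · refine ⟨_, e1, ?_, p1⟩
      have : p = r * swap i c * swap c j := by
        rw [hp, hq, mul_assoc, mul_assoc, swap_mul_eq_mul_swap (swap i c) i j, swap_inv,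
          swap_apply_left, swap_apply_of_ne_of_ne hij.ne' hc'.2.symm]
      rw [this]
      refine (edge_mul_swap_iff h).2 ?_
      simpa [swap_apply_of_ne_of_ne hij.ne' h.ne'] using hr
    · refine ⟨r * swap j c, (edge_mul_swap_iff h).2 ?_, ?_, ?_⟩
      · rw [hrc]; exact apply_lt_last (by rw [h1]; exact h.ne)
      · have : p = r * swap j c * swap i j := by
          rw [hp, hq, mul_assoc, mul_assoc, mul_swap_eq_swap_mul (swap i j) i c, swap_apply_left,
            swap_apply_of_ne_of_ne hc'.1 hc'.2]
        rw [this]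
        refine (edge_mul_swap_iff hij).2 ?_
        simpa [swap_apply_of_ne_of_ne hij.ne hlt.ne] using hra
      · rw [pos_mul_swap, h1, swap_apply_right]; exact h
  · refine ⟨_, e1, ?_, p1⟩
    by_cases hja : j = a
    · subst hja
      have : p = r * swap j c * swap i c := by
        rw [hp, hq, mul_assoc, mul_assoc, swap_mul_eq_mul_swap (swap j c) i j, swap_inv,
          swap_apply_left, swap_apply_of_ne_of_ne hij.ne hc'.1.symm]
      rw [this]
      refine (edge_mul_swap_iff (hij.trans hlt)).2 ?_
      simpa [swap_apply_of_ne_of_ne hij.ne (Ne.symm hc'.1)] using hr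
    · have : p = r * swap a c * swap i j := by
        rw [hp, hq, mul_assoc, mul_assoc, swap_mul_swap_comm hia (Ne.symm hc'.1) hja (Ne.symm hc'.2)]
      rw [this]
      refine (edge_mul_swap_iff hij).2 ?_
      simpa [swap_apply_of_ne_of_ne hia (Ne.symm hc'.1),
        swap_apply_of_ne_of_ne hja (Ne.symm hc'.2)] using hr

/-- Induction along a shortest path. The hypothesis on last steps passes from `p` to a penultimate
vertex `q` if `pos q` is chosen minimal, because `exists_flip` would otherwise move it further left.
Then `pos q` is added to the set obtained for `q`. -/
theorem isShift_of_forall {u p : Perm (Fin (m + 1))} {k : ℕ} (hk : Walk k u p)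
    (hmin : ∀ r, Walk r u p → k ≤ r)
    (hpos : ∀ q j, Walk j u q → Edge q p → j + 1 = k → pos q ≠ pos p) :
    ∃ B, IsRising (pos p) p B ∧ u = shift (pos p) p B ∧ B.card = k := by
  classical
  induction k generalizing p with
  | zero =>
    obtain rfl : u = p := hk
    exact ⟨∅, isRising_pos_iff.2 ⟨by simp, by simp [StrictMonoOn]⟩, by simp, rfl⟩
  | succ k ih =>
    obtain ⟨w, hw, hwp⟩ := hk
    obtain ⟨q, hq, hqmin⟩ := (Finset.univ.filter fun q => Walk k u q ∧ Edge q p).exists_min_image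
      pos ⟨w, by simp [hw, hwp]⟩
    obtain ⟨hq, hqp⟩ := (Finset.mem_filter.1 hq).2
    have hqp' := hpos q k hq hqp rfl
    obtain ⟨hlt, hp⟩ := (hqp.eq_or_of_pos).resolve_left (Ne.symm hqp')
    obtain ⟨B, hB, hu, hBk⟩ := ih hq (fun r hr => by have := hmin _ (hr.snoc hqp); omega) (by
      intro r j hr hrq hj hrpos
      obtain ⟨q', h1, h2, h3⟩ := exists_flip hrq hqp hrpos hqp'
      have := hqmin q' (Finset.mem_filter.2 ⟨Finset.mem_univ _, hj ▸ hr.snoc h1, h2⟩)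
      exact absurd h3 (not_lt.2 this))
    obtain ⟨a, ha⟩ : ∃ a, a = pos p := ⟨_, rfl⟩
    obtain ⟨c, hc⟩ : ∃ c, c = pos q := ⟨_, rfl⟩
    rw [← ha, ← hc] at hlt hp
    rw [← hc] at hB hu
    have hcB : ∀ b ∈ B, c < b := hB.lt
    have haB : ∀ b ∈ B, a < b := fun b hb => hlt.trans (hcB b hb)
    have hpb : ∀ b ∈ B, p b = q b := fun b hb => by
      rw [hp, Perm.mul_apply, swap_apply_of_ne_of_ne (haB b hb).ne' (hcB b hb).ne']
    have hpc : p c = q a := by rw [hp, Perm.mul_apply, swap_apply_right]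
    refine ⟨insert c B, isRising_pos_iff.2 ⟨?_, ?_⟩, ?_, ?_⟩
    · rw [← ha]
      intro b hb
      rcases Finset.mem_insert.1 hb with rfl | hb
      · exact hlt
      · exact haB b hb
    -- Otherwise there is another shortest path, through `q * swap c b` and `q * swap c b * swap a
    -- b`, whose last step does not move the largest value.
    · have hlow : ∀ b ∈ B, p c < p b := by
        intro b hb
        rw [hpb b hb, hpc]
        by_contra hlt'
        have hcb := hcB b hb
        have hab := haB b hb
        have hba : q b < q a := lt_of_le_of_ne (not_lt.1 hlt') fun h => hab.ne' (q.injective h)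
        have hw := hB.walk (Finset.singleton_subset_iff.2 hb)
        rw [← hu, shift_singleton, Finset.card_sdiff_of_subset (Finset.singleton_subset_iff.2 hb),
          Finset.card_singleton] at hw
        have hqc : q c = Fin.last m := pos_eq_iff.1 hc.symm
        have e1 : Edge (q * swap c b) (q * swap c b * swap a b) := by
          refine (edge_mul_swap_iff hab).2 ?_
          simp only [Perm.mul_apply, swap_apply_right, swap_apply_of_ne_of_ne hlt.ne hab.ne, hqc]
          exact apply_lt_last (hc ▸ hlt.ne)
        have hp' : p = q * swap c b * swap a b * swap c b := by
          rw [hp, mul_assoc q, mul_assoc q, swap_comm c b,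
            swap_mul_swap_mul_swap hab.ne hlt.ne, swap_comm]
        have e2 : Edge (q * swap c b * swap a b) p := by
          rw [hp']
          refine (edge_mul_swap_iff hcb).2 ?_
          simpa [swap_apply_of_ne_of_ne hlt.ne' hcb.ne, swap_apply_of_ne_of_ne hlt.ne hab.ne]
            using hba
        have hpos' := hpos _ _ (hw.snoc e1) e2 (by
          have := Finset.card_pos.2 ⟨b, hb⟩
          omega)
        apply hpos'
        rw [pos_mul_swap, pos_mul_swap, ← hc, swap_apply_left, swap_apply_right, ha]
      intro b hb d hd hbd
      rcases Finset.mem_insert.1 (Finset.mem_coe.1 hb) with rfl | hb'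
      · rcases Finset.mem_insert.1 (Finset.mem_coe.1 hd) with rfl | hd'
        · exact absurd hbd (lt_irrefl _)
        · exact hlow d hd'
      · rcases Finset.mem_insert.1 (Finset.mem_coe.1 hd) with rfl | hd'
        · exact absurd hbd (hcB b hb').asymm
        · rw [hpb b hb', hpb d hd']
          exact hB.mono hb' hd' hbd
    · rw [← ha, shift_insert hcB, hp, shift_mul_swap (fun h => (haB a h).false)
        (fun h => (hcB c h).false), mul_assoc, swap_mul_self, mul_one, hu]
    · rw [Finset.card_insert_of_notMem fun h => (hcB c h).false, hBk]

theorem isShift_iff {u p : Perm (Fin (m + 1))} (hup : LE u p) :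
    IsShift u p ↔ ∀ q j, Walk j u q → Edge q p → j + 1 = dist u p → pos q ≠ pos p := by
  refine ⟨fun h q j hj he hd => h.pos_ne hj he hd, fun h => ?_⟩
  obtain ⟨B, h1, h2, -⟩ := isShift_of_forall hup.walk_dist (fun r hr => dist_le hr) h
  exact ⟨B, h1, h2⟩

/-- By monotonicity of the position, a path to `p` that enters `[z, v]` stays there until `p`. So
being a shortcut only concerns the last steps of shortest paths, as in `isShift_iff`. -/
theorem IsStandard.mem_shortcuts_iff {φ : Perm (Fin (m + 1)) ≃ Perm (Fin (m + 1))}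
    {u v z p : Perm (Fin (m + 1))} (hφ : IsAut φ) (hz : IsStandard φ u v z) :
    p ∈ shortcuts u v z ↔ LE p v ∧ pos (φ p) = pos (φ v) ∧ IsShift (φ u) (φ p) := by
  rw [mem_shortcuts_iff_walk hz.1.1.1]
  constructor
  · rintro ⟨hp, h⟩
    rw [hz.mem_interval_iff hφ] at hp
    refine ⟨hp.1.2, hp.2, (isShift_iff (hφ.map_le hp.1.1)).2 fun q j hj he hd hpos => ?_⟩
    obtain ⟨q, rfl⟩ := φ.surjective q
    rw [hφ.walk_iff] at hj
    rw [hφ.edge_iff] at he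
    rw [hφ.dist_eq] at hd
    have hqp := h q ((hz.mem_interval_iff hφ).2 ⟨⟨hj.le, he.le.trans hp.1.2⟩, hpos.trans hp.2⟩)
      j 1 hj ⟨q, rfl, he⟩ hd
    exact (hqp ▸ he.2).false
  · rintro ⟨hpv, hp, hs⟩
    refine ⟨(hz.mem_interval_iff hφ).2 ⟨⟨hφ.le_iff.1 hs.le, hpv⟩, hp⟩, ?_⟩
    intro q hq j k hj hk hd
    rw [hz.mem_interval_iff hφ] at hq
    cases k with
    | zero => exact hk
    | succ k =>
      obtain ⟨w, hw, hwp⟩ := hk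
      have h1 := hs.pos_ne (hφ.map_walk (hj.append hw)) (hφ.edge_iff.2 hwp)
        (by rw [hφ.dist_eq, ← hd]; rfl)
      have h2 := hφ.pos_le hwp.le
      have h3 := hφ.pos_le hw.le
      rw [hq.2, ← hp] at h3
      exact absurd (le_antisymm h3 h2) h1

end

/-! ### The Hecke algebra and its R-polynomials. -/

section

variable {m : ℕ}

/-! ### Simple transpositions -/

/-- The simple transpositions. -/
def simple (i : Fin m) : Perm (Fin (m + 1)) := swap i.castSucc i.succ

/-- `x` is shorter than `x * simple i`. -/
def IsAscent (x : Perm (Fin (m + 1))) (i : Fin m) : Prop := x i.castSucc < x i.succ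

instance (x : Perm (Fin (m + 1))) (i : Fin m) : Decidable (IsAscent x i) :=
  inferInstanceAs (Decidable (_ < _))

theorem simple_mul_simple (i : Fin m) : simple i * simple i = 1 := swap_mul_self _ _

theorem simple_inv (i : Fin m) : (simple i)⁻¹ = simple i := swap_inv _ _

theorem mul_simple_mul_simple (x : Perm (Fin (m + 1))) (i : Fin m) :
    x * simple i * simple i = x := by
  rw [mul_assoc, simple_mul_simple, mul_one]

theorem simple_mul_simple_mul (x : Perm (Fin (m + 1))) (i : Fin m) :
    simple i * (simple i * x) = x := by
  rw [← mul_assoc, simple_mul_simple, one_mul]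

theorem isAscent_mul_simple {x : Perm (Fin (m + 1))} {i : Fin m} :
    IsAscent (x * simple i) i ↔ ¬ IsAscent x i := by
  have : x i.castSucc ≠ x i.succ := fun h => (Fin.castSucc_lt_succ (i := i)).ne (x.injective h)
  simp only [IsAscent, simple, Perm.mul_apply, swap_apply_left, swap_apply_right, not_lt]
  exact ⟨le_of_lt, fun h => lt_of_le_of_ne h this.symm⟩

theorem IsAscent.edge {x : Perm (Fin (m + 1))} {i : Fin m} (h : IsAscent x i) :
    Edge x (x * simple i) :=
  (edge_mul_swap_iff Fin.castSucc_lt_succ).2 h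

theorem exists_not_isAscent {x : Perm (Fin (m + 1))} (h : x ≠ 1) : ∃ i, ¬ IsAscent x i := by
  by_contra! H
  apply h
  have hx : StrictMono x := Fin.strictMono_iff_lt_succ.2 H
  ext i
  have : (OrderIso.ofRelIsoLT ⟨x, hx.lt_iff_lt⟩ : Fin (m + 1) ≃o Fin (m + 1)) = OrderIso.refl _ :=
    Subsingleton.elim _ _
  exact congrArg (fun f : Fin (m + 1) ≃o Fin (m + 1) => (f i).val) this

theorem induction_mul_simple {P : Perm (Fin (m + 1)) → Prop} (h1 : P 1)
    (h2 : ∀ w i, IsAscent w i → P w → P (w * simple i)) (w : Perm (Fin (m + 1))) : P w := by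
  induction hk : length w using Nat.strong_induction_on generalizing w with
  | _ k ih =>
    by_cases hw : w = 1
    · exact hw ▸ h1
    · obtain ⟨i, hi⟩ := exists_not_isAscent hw
      have hi' := isAscent_mul_simple.2 hi
      have := h2 _ i hi' (ih _ (by
        have := hi'.edge.2
        rwa [mul_simple_mul_simple, hk] at this) _ rfl)
      rwa [mul_simple_mul_simple] at this

theorem isAscent_simple_mul {x : Perm (Fin (m + 1))} {i j : Fin m}
    (h : simple i * x ≠ x * simple j) : IsAscent (simple i * x) j ↔ IsAscent x j := by
  have hj : x j.castSucc ≠ x j.succ := fun hh =>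
    (Fin.castSucc_lt_succ (i := j)).ne (x.injective hh)
  have hne : ¬ (x j.castSucc = i.castSucc ∧ x j.succ = i.succ) := by
    rintro ⟨h1, h2⟩
    apply h; rw [simple, simple, mul_swap_eq_swap_mul, h1, h2]
  have hne' : ¬ (x j.castSucc = i.succ ∧ x j.succ = i.castSucc) := by
    rintro ⟨h1, h2⟩
    apply h; rw [simple, simple, mul_swap_eq_swap_mul, h1, h2, swap_comm]
  simp only [IsAscent, simple, Perm.mul_apply]
  generalize x j.castSucc = a at *
  generalize x j.succ = b at *
  rw [swap_apply_def, swap_apply_def]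
  simp only [Fin.ext_iff, Fin.val_castSucc, Fin.val_succ, ne_eq, Fin.lt_def] at *
  split_ifs <;> simp only [Fin.val_castSucc, Fin.val_succ] <;> omega

/-- The lifting property. -/
theorem LE.mul_simple {x y : Perm (Fin (m + 1))} {i : Fin m} (hy : IsAscent y i)
    (h : LE (x * simple i) y) : LE x (y * simple i) := by
  by_cases hx : IsAscent x i
  · exact (hx.edge.le.trans h).trans hy.edge.le
  have hx' := isAscent_mul_simple.2 hx
  rw [← mul_simple_mul_simple x i]
  generalize x * simple i = x at h hx'
  rw [le_iff_rank_le]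
  intro k j
  rw [simple, rank_mul_swap _ Fin.castSucc_lt_succ.ne, rank_mul_swap _ Fin.castSucc_lt_succ.ne]
  have h0 := h.rank_le k j
  have h1 := h.rank_le i j
  have h2 := h.rank_le (i + 1) j
  have h3 := h.rank_le (i + 1 + 1) j
  have h4 := rank_succ x i.castSucc j
  have h5 := rank_succ x i.succ j
  have h6 := rank_succ y i.castSucc j
  have h7 := rank_succ y i.succ j
  rw [IsAscent, Fin.lt_def] at hx' hy
  simp only [Fin.val_castSucc, Fin.val_succ] at *
  -- Multiplying by the simple transposition changes only the row `i + 1` of the rank function; that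
  -- row is controlled by the rows `i` and `i + 2`.
  by_cases hk : k = i + 1
  · subst hk
    simp only [lt_add_iff_pos_right, zero_lt_one, if_true, lt_irrefl, if_false]
    split_ifs at * <;> omega
  · have : (if i.val < k then (1 : ℤ) else 0) - (if i.val + 1 < k then 1 else 0) = 0 := by
      split_ifs <;> omega
    rw [this]
    omega

/-! ### The regular representation of the Hecke algebra -/

/-- Right multiplication by the inverse of a standard generator of the Hecke algebra. -/
noncomputable def rightOp (i : Fin m) : Module.End ℤ[X] (Perm (Fin (m + 1)) → ℤ[X]) where
  toFun F u := F (u * simple i) + if IsAscent u i then X * F u else 0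
  map_add' F G := by ext1 u; simp only [Pi.add_apply]; split_ifs <;> ring
  map_smul' c F := by
    ext1 u; simp only [Pi.smul_apply, smul_eq_mul, RingHom.id_apply]; split_ifs <;> ring

/-- Left multiplication by the inverse of a standard generator of the Hecke algebra. -/
noncomputable def leftOp (i : Fin m) : Module.End ℤ[X] (Perm (Fin (m + 1)) → ℤ[X]) where
  toFun F u := F (simple i * u) + if IsAscent u⁻¹ i then X * F u else 0
  map_add' F G := by ext1 u; simp only [Pi.add_apply]; split_ifs <;> ring
  map_smul' c F := by
    ext1 u; simp only [Pi.smul_apply, smul_eq_mul, RingHom.id_apply]; split_ifs <;> ring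

theorem rightOp_apply (i : Fin m) (F : Perm (Fin (m + 1)) → ℤ[X]) (u : Perm (Fin (m + 1))) :
    rightOp i F u = F (u * simple i) + if IsAscent u i then X * F u else 0 := rfl

theorem leftOp_apply (i : Fin m) (F : Perm (Fin (m + 1)) → ℤ[X]) (u : Perm (Fin (m + 1))) :
    leftOp i F u = F (simple i * u) + if IsAscent u⁻¹ i then X * F u else 0 := rfl

/-- Left and right ascents interact only if `simple i * u = u * simple j`, and in that case they
coincide at `u` and are both reversed. -/
theorem leftOp_mul_rightOp (i j : Fin m) : leftOp i * rightOp j = rightOp j * leftOp i := by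
  refine LinearMap.ext fun F => funext fun u => ?_
  simp only [Module.End.mul_apply, leftOp_apply, rightOp_apply, mul_assoc]
  by_cases h : simple i * u = u * simple j
  · have h1 : IsAscent (simple i * u) j ↔ ¬ IsAscent u j := by rw [h, isAscent_mul_simple]
    have h2 : IsAscent (u * simple j)⁻¹ i ↔ ¬ IsAscent u⁻¹ i := by
      rw [← h, mul_inv_rev, simple_inv, isAscent_mul_simple]
    have h3 : IsAscent u⁻¹ i ↔ IsAscent u j := by
      have hs : simple i = swap (u j.castSucc) (u j.succ) := by
        rw [← mul_left_inj u, ← mul_swap_eq_swap_mul]; exact h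
      have hj : u j.castSucc ≠ u j.succ := fun hh =>
        (Fin.castSucc_lt_succ (i := j)).ne (u.injective hh)
      have hi := Fin.castSucc_lt_succ (i := i)
      have hv : i.succ = swap (u j.castSucc) (u j.succ) i.castSucc := by
        rw [← hs, simple, swap_apply_left]
      have hne : swap (u j.castSucc) (u j.succ) i.castSucc ≠ i.castSucc := by
        rw [← hv]; exact hi.ne'
      have hlj := Fin.castSucc_lt_succ (i := j)
      rcases (swap_apply_ne_self_iff.1 hne).2 with h' | h'
      · rw [h', swap_apply_left] at hv
        exact iff_of_true (by rw [IsAscent, h', hv]; simp)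
          (by rw [IsAscent, ← h', ← hv]; exact hi)
      · rw [h', swap_apply_right] at hv
        exact iff_of_false (by rw [IsAscent, h', hv]; simpa using hlj.le)
          (by rw [IsAscent, ← h', ← hv]; exact hi.asymm)
    rw [h]
    rw [h] at h1
    simp only [h1, h2, h3]
  · have h1 : IsAscent (simple i * u) j ↔ IsAscent u j := isAscent_simple_mul h
    have h2 : IsAscent (u * simple j)⁻¹ i ↔ IsAscent u⁻¹ i := by
      rw [mul_inv_rev, simple_inv]
      refine isAscent_simple_mul fun hh => h ?_
      rw [← inv_inj, mul_inv_rev, mul_inv_rev, simple_inv, simple_inv, hh]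
    simp only [h1, h2]
    split_ifs <;> ring

theorem leftOp_mul_self (i : Fin m) : leftOp i * leftOp i = (X : ℤ[X]) • leftOp i + 1 := by
  refine LinearMap.ext fun F => funext fun u => ?_
  have h : IsAscent (simple i * u)⁻¹ i ↔ ¬ IsAscent u⁻¹ i := by
    rw [mul_inv_rev, simple_inv, isAscent_mul_simple]
  simp only [Module.End.mul_apply, leftOp_apply, simple_mul_simple_mul, h, LinearMap.add_apply,
    LinearMap.smul_apply, Module.End.one_apply, Pi.add_apply, Pi.smul_apply, smul_eq_mul]
  split_ifs <;> first | contradiction | ring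

/-- Left multiplication by a standard generator of the Hecke algebra. -/
noncomputable def leftGen (i : Fin m) : Module.End ℤ[X] (Perm (Fin (m + 1)) → ℤ[X]) :=
  leftOp i - (X : ℤ[X]) • 1

/-- Right multiplication by a standard generator of the Hecke algebra. -/
noncomputable def rightGen (i : Fin m) : Module.End ℤ[X] (Perm (Fin (m + 1)) → ℤ[X]) :=
  rightOp i - (X : ℤ[X]) • 1

theorem leftOp_mul_leftGen (i : Fin m) : leftOp i * leftGen i = 1 := by
  rw [leftGen, mul_sub, leftOp_mul_self, mul_smul_comm, mul_one, add_sub_cancel_left]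

theorem leftGen_mul_leftOp (i : Fin m) : leftGen i * leftOp i = 1 := by
  rw [leftGen, sub_mul, leftOp_mul_self, smul_mul_assoc, one_mul, add_sub_cancel_left]

theorem leftGen_mul_rightGen (i j : Fin m) : Commute (leftGen i) (rightGen j) := by
  unfold leftGen rightGen
  exact Commute.sub_left (Commute.sub_right (leftOp_mul_rightOp i j)
    ((Commute.one_right _).smul_right _))
    (((Commute.one_left _).smul_left _))

/-- The standard basis of the Hecke algebra. -/
noncomputable def basisVec (w : Perm (Fin (m + 1))) : Perm (Fin (m + 1)) → ℤ[X] := Pi.single w 1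

theorem basisVec_apply (w u : Perm (Fin (m + 1))) :
    basisVec w u = if u = w then 1 else 0 := Pi.single_apply _ _ _

theorem rightGen_basisVec {w : Perm (Fin (m + 1))} {i : Fin m} (h : IsAscent w i) :
    rightGen i (basisVec w) = basisVec (w * simple i) := by
  funext u
  have e : u * simple i = w ↔ u = w * simple i := by
    constructor
    · rintro rfl; rw [mul_simple_mul_simple]
    · rintro rfl; rw [mul_simple_mul_simple]
  simp only [rightGen, LinearMap.sub_apply, Pi.sub_apply, rightOp_apply, LinearMap.smul_apply,
    Module.End.one_apply, Pi.smul_apply, smul_eq_mul, basisVec_apply, e]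
  by_cases hu : u = w
  · subst hu; simp [h]
  · simp [hu]

theorem leftGen_basisVec {w : Perm (Fin (m + 1))} {i : Fin m} (h : IsAscent w⁻¹ i) :
    leftGen i (basisVec w) = basisVec (simple i * w) := by
  funext u
  have e : simple i * u = w ↔ u = simple i * w := by
    constructor
    · rintro rfl; rw [simple_mul_simple_mul]
    · rintro rfl; rw [simple_mul_simple_mul]
  simp only [leftGen, LinearMap.sub_apply, Pi.sub_apply, leftOp_apply, LinearMap.smul_apply,
    Module.End.one_apply, Pi.smul_apply, smul_eq_mul, basisVec_apply, e]
  by_cases hu : u = w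
  · subst hu; simp [h]
  · simp [hu]

theorem leftOp_basisVec_one (i : Fin m) : leftOp i (basisVec 1) = rightOp i (basisVec 1) := by
  funext u
  have e : simple i * u = 1 ↔ u * simple i = 1 := mul_eq_one_comm
  simp only [leftOp_apply, rightOp_apply, basisVec_apply, e]
  by_cases hu : u = 1
  · subst hu; simp
  · simp [hu]

theorem leftGen_basisVec_one (i : Fin m) : leftGen i (basisVec 1) = rightGen i (basisVec 1) := by
  simp only [leftGen, rightGen, LinearMap.sub_apply, leftOp_basisVec_one]

/-- The product of the standard generators of the Hecke algebra along a word. -/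
noncomputable def wordGen (l : List (Fin m)) : Module.End ℤ[X] (Perm (Fin (m + 1)) → ℤ[X]) :=
  (l.map leftGen).prod

/-- The inverse of `wordGen l`. -/
noncomputable def wordOp (l : List (Fin m)) : Module.End ℤ[X] (Perm (Fin (m + 1)) → ℤ[X]) :=
  (l.reverse.map leftOp).prod

theorem wordOp_mul_wordGen (l : List (Fin m)) : wordOp l * wordGen l = 1 := by
  induction l with
  | nil => simp [wordOp, wordGen]
  | cons i l ih =>
    simp only [wordOp, wordGen, List.reverse_cons, List.map_append, List.map_cons, List.map_nil,
      List.prod_append, List.prod_cons, List.prod_nil, mul_one] at *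
    rw [mul_assoc, ← mul_assoc (leftOp i), leftOp_mul_leftGen, one_mul, ih]

theorem wordGen_mul_wordOp (l : List (Fin m)) : wordGen l * wordOp l = 1 := by
  induction l with
  | nil => simp [wordOp, wordGen]
  | cons i l ih =>
    simp only [wordOp, wordGen, List.reverse_cons, List.map_append, List.map_cons, List.map_nil,
      List.prod_append, List.prod_cons, List.prod_nil, mul_one] at *
    rw [mul_assoc, ← mul_assoc _ _ (leftOp i), ih, one_mul, leftGen_mul_leftOp]

theorem commute_wordGen (l : List (Fin m)) (j : Fin m) : Commute (wordGen l) (rightGen j) := by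
  refine Commute.list_prod_left _ _ fun A hA => ?_
  obtain ⟨i, -, rfl⟩ := List.mem_map.1 hA
  exact leftGen_mul_rightGen i j

theorem commute_wordOp (l : List (Fin m)) (j : Fin m) : Commute (wordOp l) (rightOp j) := by
  refine Commute.list_prod_left _ _ fun A hA => ?_
  obtain ⟨i, -, rfl⟩ := List.mem_map.1 hA
  exact leftOp_mul_rightOp i j

/-- An operator commuting with all right generators is determined by its value on the basis vector
of `1`, from which these generators produce the whole basis. This makes braid relations and
Matsumoto's theorem unnecessary. -/
theorem wordGen_eq {l l' : List (Fin m)}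
    (h : wordGen l (basisVec 1) = wordGen l' (basisVec 1)) : wordGen l = wordGen l' := by
  have key : ∀ w, wordGen l (basisVec w) = wordGen l' (basisVec w) := by
    intro w
    induction w using induction_mul_simple with
    | h1 => exact h
    | h2 w i hw ih =>
      rw [← rightGen_basisVec hw, ← Module.End.mul_apply, ← Module.End.mul_apply,
        (commute_wordGen l i).eq, (commute_wordGen l' i).eq, Module.End.mul_apply,
        Module.End.mul_apply, ih]
  refine LinearMap.pi_ext fun w c => ?_
  have : (Pi.single w c : Perm (Fin (m + 1)) → ℤ[X]) = c • basisVec w := by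
    rw [basisVec, ← Pi.single_smul, smul_eq_mul, mul_one]
  rw [this, map_smul, map_smul, key]

theorem wordOp_eq {l l' : List (Fin m)}
    (h : wordGen l (basisVec 1) = wordGen l' (basisVec 1)) : wordOp l = wordOp l' := by
  rw [← mul_one (wordOp l), ← wordGen_mul_wordOp l', ← wordGen_eq h, ← mul_assoc,
    wordOp_mul_wordGen, one_mul]

theorem exists_word (w : Perm (Fin (m + 1))) :
    ∃ l : List (Fin m), wordGen l (basisVec 1) = basisVec w := by
  induction w using induction_mul_simple with
  | h1 => exact ⟨[], rfl⟩
  | h2 w i hw ih =>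
    obtain ⟨l, hl⟩ := ih
    refine ⟨l ++ [i], ?_⟩
    rw [← rightGen_basisVec hw, ← hl, ← Module.End.mul_apply, ← (commute_wordGen l i).eq,
      Module.End.mul_apply, ← leftGen_basisVec_one]
    simp [wordGen]

/-! ### The `R`-polynomials -/

/-- `rPoly v u` is the `R`-polynomial `R̃_{u,v}`: these are the coefficients of the image of the
standard basis vector of `v` under the bar involution. -/
noncomputable def rPoly (v : Perm (Fin (m + 1))) : Perm (Fin (m + 1)) → ℤ[X] :=
  wordOp (exists_word v⁻¹).choose (basisVec 1)

/-- The bar involution sends `T_v` to the inverse of `T_{v⁻¹}`, hence the `v⁻¹`; the choice of the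
word does not matter. -/
theorem rPoly_eq {v : Perm (Fin (m + 1))} {l : List (Fin m)}
    (h : wordGen l (basisVec 1) = basisVec v⁻¹) : rPoly v = wordOp l (basisVec 1) := by
  rw [rPoly, wordOp_eq (h.trans (exists_word v⁻¹).choose_spec.symm)]

theorem rPoly_one : rPoly (1 : Perm (Fin (m + 1))) = basisVec 1 := by
  rw [rPoly_eq (l := []) (by simp [wordGen])]
  simp [wordOp]

theorem rPoly_simple_mul {v : Perm (Fin (m + 1))} {i : Fin m} (h : IsAscent v⁻¹ i) :
    rPoly (simple i * v) = leftOp i (rPoly v) := by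
  obtain ⟨l, hl⟩ := exists_word v⁻¹
  rw [rPoly_eq hl, rPoly_eq (l := l ++ [i])]
  · simp [wordOp]
  · rw [mul_inv_rev, simple_inv, ← rightGen_basisVec h, ← hl, ← Module.End.mul_apply,
      ← (commute_wordGen l i).eq, Module.End.mul_apply, ← leftGen_basisVec_one]
    simp [wordGen]

theorem rPoly_mul_simple {v : Perm (Fin (m + 1))} {i : Fin m} (h : IsAscent v i) :
    rPoly (v * simple i) = rightOp i (rPoly v) := by
  obtain ⟨l, hl⟩ := exists_word v⁻¹
  rw [rPoly_eq hl, rPoly_eq (l := i :: l)]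
  · rw [← Module.End.mul_apply (rightOp i), ← (commute_wordOp l i).eq, Module.End.mul_apply,
      ← leftOp_basisVec_one]
    simp [wordOp]
  · rw [mul_inv_rev, simple_inv, ← leftGen_basisVec (by rwa [inv_inv]), ← hl]
    simp [wordGen]

theorem le_of_rPoly_ne_zero {u v : Perm (Fin (m + 1))} (h : rPoly v u ≠ 0) : LE u v := by
  induction v using induction_mul_simple generalizing u with
  | h1 =>
    rw [rPoly_one, basisVec_apply] at h
    by_cases hu : u = 1
    · rw [hu]; exact LE.refl 1
    · simp [hu] at h
  | h2 v i hv ih =>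
    rw [rPoly_mul_simple hv, rightOp_apply] at h
    by_cases h1 : rPoly v (u * simple i) = 0
    · rw [h1, zero_add] at h
      split_ifs at h
      · exact (ih (right_ne_zero_of_mul h)).trans hv.edge.le
      · exact absurd rfl h
    · exact (ih h1).mul_simple hv

theorem rPoly_self (v : Perm (Fin (m + 1))) : rPoly v v = 1 := by
  induction v using induction_mul_simple with
  | h1 => rw [rPoly_one, basisVec_apply, if_pos rfl]
  | h2 v i hv ih =>
    rw [rPoly_mul_simple hv, rightOp_apply, mul_simple_mul_simple, ih,
      if_neg (fun h => isAscent_mul_simple.1 h hv), add_zero]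

/-- Inversion exchanges the left and the right recursion, and `rPoly` satisfies both. -/
theorem rPoly_inv (v u : Perm (Fin (m + 1))) : rPoly v⁻¹ u⁻¹ = rPoly v u := by
  induction v using induction_mul_simple generalizing u with
  | h1 => rw [inv_one, rPoly_one, basisVec_apply, basisVec_apply]; simp
  | h2 v i hv ih =>
    rw [mul_inv_rev, simple_inv, rPoly_simple_mul (by rwa [inv_inv]), rPoly_mul_simple hv,
      leftOp_apply, rightOp_apply, inv_inv, ih, ← ih (u * simple i), mul_inv_rev, simple_inv]

theorem revConj_simple (i : Fin m) : revConj (simple i) = simple (Fin.rev i) := by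
  rw [simple, revConj_swap, Fin.rev_castSucc, Fin.rev_succ, swap_comm, simple]

theorem isAscent_revConj {x : Perm (Fin (m + 1))} {i : Fin m} :
    IsAscent (revConj x) (Fin.rev i) ↔ IsAscent x i := by
  simp [IsAscent, revConj_apply, Fin.rev_castSucc, Fin.rev_succ]

theorem rPoly_revConj (v u : Perm (Fin (m + 1))) : rPoly (revConj v) (revConj u) = rPoly v u := by
  induction v using induction_mul_simple generalizing u with
  | h1 =>
    have : revConj (1 : Perm (Fin (m + 1))) = 1 := by ext; simp [revConj_apply]
    have h : revConj u = 1 ↔ u = 1 := by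
      refine ⟨fun h => ?_, fun h => by rw [h, this]⟩
      rw [← revConj_revConj u, h, this]
    rw [this, rPoly_one, basisVec_apply, basisVec_apply]
    simp [h]
  | h2 v i hv ih =>
    rw [revConj_mul, revConj_simple, rPoly_mul_simple (isAscent_revConj.2 hv), rPoly_mul_simple hv,
      rightOp_apply, rightOp_apply, ← revConj_simple, ← revConj_mul, ih, ih]
    simp only [isAscent_revConj]

end

/-! ### The shortcut formula for R-polynomials. -/

section

variable {m : ℕ}

/-! ### The shortcut polynomials -/

theorem IsRising.shift_insert_apply_self {n : ℕ} {a : Fin n} {p : Perm (Fin n)} {e : Fin n}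
    {B : Finset (Fin n)} (h : IsRising a p (insert e B)) (he : ∀ b ∈ B, e < b) :
    shift a p (insert e B) a = p e := by
  rw [shift_insert he, Perm.mul_apply, swap_apply_left,
    shift_apply_of_notMem p (h.lt e (by simp)).ne' fun hh => (he e hh).false]

open Classical in
/-- The generating function of the permutations `u` with `IsShift u p` by their distance to `p`. -/
noncomputable def shiftPoly (p : Perm (Fin (m + 1))) : Perm (Fin (m + 1)) → ℤ[X] := fun u =>
  ∑ B ∈ (Finset.Ioi (pos p)).powerset,
    if StrictMonoOn p B ∧ shift (pos p) p B = u then X ^ B.card else 0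

open Classical in
theorem shiftPoly_apply (p u : Perm (Fin (m + 1))) :
    shiftPoly p u = if IsShift u p then X ^ dist u p else 0 := by
  have hsub : ∀ B, B ∈ (Finset.Ioi (pos p)).powerset ↔ ∀ b ∈ B, pos p < b := fun B => by
    rw [Finset.mem_powerset]
    exact ⟨fun h b hb => Finset.mem_Ioi.1 (h hb), fun h b hb => Finset.mem_Ioi.2 (h b hb)⟩
  unfold shiftPoly
  split_ifs with h
  · obtain ⟨B, hB, rfl⟩ := h
    rw [hB.dist_eq, Finset.sum_eq_single B]
    · rw [if_pos ⟨hB.mono, rfl⟩]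
    · intro C hC hne
      refine if_neg fun hC' => hne ?_
      exact shift_injective (isRising_pos_iff.2 ⟨(hsub C).1 hC, hC'.1⟩) hB hC'.2
    · intro hB'
      exact absurd ((hsub B).2 hB.lt) hB'
  · refine Finset.sum_eq_zero fun B hB => if_neg fun hB' => h ?_
    exact ⟨B, isRising_pos_iff.2 ⟨(hsub B).1 hB, hB'.1⟩, hB'.2.symm⟩

theorem shiftPoly_of_pos_eq_last {p : Perm (Fin (m + 1))} (h : pos p = Fin.last m) :
    shiftPoly p = basisVec p := by
  funext u
  have : Finset.Ioi (Fin.last m) = ∅ := by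
    ext c; simp [Fin.le_last]
  simp [shiftPoly, h, this, basisVec_apply, StrictMonoOn, eq_comm]

/-- Split the sets `B` according to whether they contain the position `c` next to `pos p`. Those
without `c` give the term at `u * simple i`; those with `c` give `X` times the term at `u`, and `p`
increases on such a set exactly when it does so without `c` and `u` has an ascent at `i`. -/
theorem shiftPoly_eq_rightOp {p : Perm (Fin (m + 1))} {i : Fin m} (h : pos p = i.castSucc) :
    shiftPoly p = rightOp i (shiftPoly (p * simple i)) := by
  classical
  set a := i.castSucc with ha
  set c := i.succ with hc
  have hac : a < c := Fin.castSucc_lt_succ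
  obtain ⟨q, hq⟩ : ∃ q, q = p * simple i := ⟨_, rfl⟩
  have hp : p = q * swap a c := by rw [hq]; exact (mul_simple_mul_simple p i).symm
  have hqpos : pos q = c := by rw [hq, simple, pos_mul_swap, h, swap_apply_left]
  have hIoi : Finset.Ioi a = insert c (Finset.Ioi c) := by
    ext d
    simp only [Finset.mem_Ioi, Finset.mem_insert, ha, hc, Fin.lt_def, Fin.ext_iff,
      Fin.val_castSucc, Fin.val_succ]
    omega
  rw [← hq]
  funext u
  rw [rightOp_apply]
  unfold shiftPoly
  rw [h, hqpos, hIoi, Finset.sum_powerset_insert (by simp)]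
  have hlt : ∀ B ∈ (Finset.Ioi c).powerset, ∀ b ∈ B, c < b := fun B hB b hb =>
    Finset.mem_Ioi.1 (Finset.mem_powerset.1 hB hb)
  have hmono : ∀ B ∈ (Finset.Ioi c).powerset, (StrictMonoOn p B ↔ StrictMonoOn q B) := by
    intro B hB
    have : Set.EqOn p q B := fun b hb => by
      have hcb := hlt B hB b hb
      rw [hp, Perm.mul_apply, swap_apply_of_ne_of_ne (hac.trans hcb).ne' hcb.ne']
    exact ⟨fun h => h.congr this, fun h => h.congr this.symm⟩
  have hshift : ∀ B ∈ (Finset.Ioi c).powerset, shift a p B = shift c q B * simple i := by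
    intro B hB
    rw [hp, shift_mul_swap (fun hh => (hac.trans (hlt B hB a hh)).false)
      (fun hh => (hlt B hB c hh).false)]
    rfl
  congr 1
  · refine Finset.sum_congr rfl fun B hB => ?_
    refine if_congr (and_congr (hmono B hB) ?_) rfl rfl
    rw [hshift B hB]
    constructor
    · rintro rfl; rw [mul_simple_mul_simple]
    · intro hh; rw [hh, mul_simple_mul_simple]
  · have hcond : ∀ B ∈ (Finset.Ioi c).powerset, (StrictMonoOn p (insert c B : Finset _) ↔
        StrictMonoOn q B ∧ IsAscent (shift c q B) i) := by
      intro B hB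
      have hcB := hlt B hB
      have hval : shift c q B a = p c := by
        rw [shift_apply_of_notMem q hac.ne fun hh => (hac.trans (hcB a hh)).false, hp,
          Perm.mul_apply, swap_apply_right]
      have hval' : shift c q B c = shift a p B a := by
        rw [hshift B hB, simple, Perm.mul_apply, ← ha, swap_apply_left]
      rw [IsAscent, ← ha, ← hc, hval, hval', ← hmono B hB]
      have hlt' : ∀ b ∈ insert c B, a < b := by
        intro b hb
        rcases Finset.mem_insert.1 hb with rfl | hb
        · exact hac
        · exact hac.trans (hcB b hb)
      constructor
      · intro hm
        refine ⟨hm.mono (by simp), ?_⟩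
        rw [← h]
        exact (isRising_pos_iff.2 ⟨h ▸ hlt', hm⟩).lt_shift_apply_self hcB
      · rintro ⟨hm, hm'⟩
        -- At position `a` the shift takes the value of `p` at the minimum of `B`, so the ascent
        -- compares `p c` with the smallest value of `p` on `B`.
        have hlow : ∀ b ∈ B, p c < p b := by
          intro b hb
          have hne : B.Nonempty := ⟨b, hb⟩
          have hins := Finset.insert_erase (B.min'_mem hne)
          have hr : IsRising a p (insert (B.min' hne) (B.erase (B.min' hne))) := by
            rw [hins, ← h]
            exact isRising_pos_iff.2 ⟨fun b hb => h ▸ hac.trans (hcB b hb), hm⟩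
          have := hr.shift_insert_apply_self fun d hd => B.min'_lt_of_mem_erase_min' hne hd
          rw [hins] at this
          rw [this] at hm'
          exact hm'.trans_le (hm.monotoneOn (B.min'_mem hne) hb (B.min'_le b hb))
        intro b hb d hd hbd
        rcases Finset.mem_insert.1 (Finset.mem_coe.1 hb) with rfl | hb'
        · rcases Finset.mem_insert.1 (Finset.mem_coe.1 hd) with rfl | hd'
          · exact absurd hbd (lt_irrefl _)
          · exact hlow d hd'
        · rcases Finset.mem_insert.1 (Finset.mem_coe.1 hd) with rfl | hd'
          · exact absurd hbd (hcB b hb').asymm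
          · exact hm hb' hd' hbd
    rw [← ite_zero_mul, Finset.mul_sum]
    refine Finset.sum_congr rfl fun B hB => ?_
    have hcB := hlt B hB
    rw [shift_insert hcB, hshift B hB, show swap a c = simple i from rfl, mul_simple_mul_simple,
      Finset.card_insert_of_notMem fun hh => (hcB c hh).false]
    simp only [hcond B hB]
    by_cases hu : shift c q B = u
    · subst hu
      by_cases h1 : StrictMonoOn q B <;> by_cases h2 : IsAscent (shift c q B) i <;>
        simp [h1, h2, pow_succ']
    · simp [hu]

/-- Downward induction on `pos v`. If the largest value is in the last position, it is so for all `u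
≤ v` with `pos u ≤ pos v` reversed by monotonicity, and each `shiftPoly p` is a basis vector.
Otherwise both sides arise by applying `rightOp i` to the formula for `v * simple i`, which is
shorter. -/
theorem rPoly_eq_sum (v : Perm (Fin (m + 1))) :
    rPoly v = ∑ p with pos p = pos v, rPoly v p • shiftPoly p := by
  obtain ⟨a, ha⟩ : ∃ a, a = pos v := ⟨_, rfl⟩
  induction a using Fin.reverseInduction generalizing v with
  | last =>
    funext u
    rw [Finset.sum_apply]
    have : ∀ p ∈ Finset.univ.filter fun p => pos p = pos v,
        (rPoly v p • shiftPoly p) u = if u = p then rPoly v p else 0 := by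
      intro p hp
      rw [shiftPoly_of_pos_eq_last ((Finset.mem_filter.1 hp).2.trans ha.symm), Pi.smul_apply,
        basisVec_apply, smul_eq_mul, mul_ite, mul_one, mul_zero]
    rw [Finset.sum_congr rfl this, Finset.sum_ite_eq]
    split_ifs with h
    · rfl
    · by_contra hne
      have := (le_of_rPoly_ne_zero hne).pos_le
      apply h
      rw [Finset.mem_filter]
      exact ⟨Finset.mem_univ _, le_antisymm ((Fin.le_last _).trans ha.le) this⟩
  | cast i ih =>
    have hv : pos (v * simple i) = i.succ := by
      rw [simple, pos_mul_swap, ← ha, swap_apply_left]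
    have hdesc : ∀ p : Perm (Fin (m + 1)), pos p = pos v → ¬ IsAscent p i := by
      intro p hp
      rw [← ha, pos_eq_iff] at hp
      rw [IsAscent, hp]
      exact not_lt.2 (Fin.le_last _)
    have hasc := isAscent_mul_simple.2 (hdesc v rfl)
    have hr := rPoly_mul_simple hasc
    rw [mul_simple_mul_simple] at hr
    nth_rw 1 [hr, ih _ hv.symm, map_sum]
    refine Finset.sum_equiv (Equiv.mulRight (simple i)) ?_ ?_
    · intro p
      simp only [Finset.mem_filter, Finset.mem_univ, true_and, Equiv.coe_mulRight]
      rw [hv, ← ha, simple, pos_mul_swap, swap_apply_eq_iff, swap_apply_left]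
    · intro p hp
      have hp' : pos (p * simple i) = pos v := by
        rw [simple, pos_mul_swap, (Finset.mem_filter.1 hp).2, hv, swap_apply_right, ha]
      rw [Equiv.coe_mulRight, map_smul, shiftPoly_eq_rightOp (hp'.trans ha.symm),
        mul_simple_mul_simple, hr, rightOp_apply, if_neg (hdesc _ hp'), add_zero,
        mul_simple_mul_simple]

end

/-! ### Symmetry of double shortcuts and the four standard decompositions. -/

section

variable {m : ℕ}

/-! ### Symmetry of double shortcuts -/

/-- `φ` is an automorphism of the Bruhat graph that preserves the `R`-polynomials. -/
structure PreservesR (φ : Perm (Fin (m + 1)) ≃ Perm (Fin (m + 1))) : Prop extends IsAut φ where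
  rPoly_eq : ∀ v u, rPoly (φ v) (φ u) = rPoly v u

section

variable {φ ψ : Perm (Fin (m + 1)) ≃ Perm (Fin (m + 1))}

theorem PreservesR.rPoly_eq_sum (hφ : PreservesR φ) (v u : Perm (Fin (m + 1))) :
    rPoly v u = ∑ p with pos (φ p) = pos (φ v), rPoly v p * shiftPoly (φ p) (φ u) := by
  rw [← hφ.rPoly_eq, BruhatSn.rPoly_eq_sum, Finset.sum_apply]
  refine (Finset.sum_equiv φ ?_ ?_).symm
  · intro p; simp
  · intro p _
    rw [Pi.smul_apply, smul_eq_mul, hφ.rPoly_eq]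

/-- The generating function of double shortcuts from `u` to `b`. -/
noncomputable def doublePoly (φ ψ : Perm (Fin (m + 1)) ≃ Perm (Fin (m + 1)))
    (b u : Perm (Fin (m + 1))) : ℤ[X] :=
  ∑ p with pos (φ p) = pos (φ b), shiftPoly (φ p) (φ u) * shiftPoly (ψ b) (ψ p)

theorem IsAut.le_of_shiftPoly_ne_zero (hφ : IsAut φ) {p u : Perm (Fin (m + 1))}
    (h : shiftPoly (φ p) (φ u) ≠ 0) : LE u p := by
  rw [shiftPoly_apply] at h
  split_ifs at h with hs
  · exact hφ.le_iff.1 hs.le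
  · exact absurd rfl h

/-- Expand `rPoly v u` with respect to `φ`, then each coefficient `rPoly v p` with respect to `ψ`,
and collect the terms by `b`. -/
theorem rPoly_eq_sum_doublePoly (hφ : PreservesR φ) (hψ : PreservesR ψ)
    (v u : Perm (Fin (m + 1))) :
    rPoly v u = ∑ b with pos (φ b) = pos (φ v) ∧ pos (ψ b) = pos (ψ v),
      rPoly v b * doublePoly φ ψ b u := by
  have hL : rPoly v u = ∑ p, ∑ b, if pos (φ p) = pos (φ v) then
      if pos (ψ b) = pos (ψ v) then
        rPoly v b * shiftPoly (ψ b) (ψ p) * shiftPoly (φ p) (φ u) else 0 else 0 := by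
    rw [hφ.rPoly_eq_sum, Finset.sum_filter]
    refine Finset.sum_congr rfl fun p _ => ?_
    split_ifs
    · rw [hψ.rPoly_eq_sum v p, Finset.sum_mul, Finset.sum_filter]
    · simp
  rw [hL, Finset.sum_comm, Finset.sum_filter]
  refine Finset.sum_congr rfl fun b _ => ?_
  rw [doublePoly, Finset.mul_sum, Finset.sum_filter]
  refine Eq.trans (b := ∑ p, if pos (φ b) = pos (φ v) ∧ pos (ψ b) = pos (ψ v) then
    if pos (φ p) = pos (φ b) then
      rPoly v b * (shiftPoly (φ p) (φ u) * shiftPoly (ψ b) (ψ p)) else 0 else 0)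
    (Finset.sum_congr rfl fun p _ => ?_) (by split_ifs <;> simp)
  by_cases h1 : rPoly v b = 0
  · simp [h1]
  by_cases h2 : shiftPoly (ψ b) (ψ p) = 0
  · simp [h2]
  have h3 := hφ.pos_le (le_of_rPoly_ne_zero h1)
  have h4 := hφ.pos_le (hψ.le_of_shiftPoly_ne_zero h2)
  -- In a nonzero term `p ≤ b ≤ v`, so the position at `b` lies between those at `v` and `p`; this
  -- makes the conditions symmetric in `φ` and `ψ`.
  have h5 : pos (φ p) = pos (φ v) ↔ pos (φ b) = pos (φ v) ∧ pos (φ p) = pos (φ b) :=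
    ⟨fun h => have hb := le_antisymm (h4.trans h.le) h3; ⟨hb, h.trans hb.symm⟩,
      fun h => h.2.trans h.1⟩
  rw [if_congr h5 rfl rfl, ite_and, ite_and]
  refine if_congr Iff.rfl ?_ rfl
  rw [← ite_and, ← ite_and, mul_assoc, mul_comm (shiftPoly (ψ b) _)]
  exact if_congr and_comm rfl rfl

/-- Take `v = b` in both expansions of `rPoly b u`. The term of `b` has coefficient `1`, and the
other nonzero ones belong to shorter `c`, where symmetry holds by induction. -/
theorem doublePoly_comm (hφ : PreservesR φ) (hψ : PreservesR ψ) (b u : Perm (Fin (m + 1))) :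
    doublePoly φ ψ b u = doublePoly ψ φ b u := by
  induction hk : length b using Nat.strong_induction_on generalizing b with
  | _ k ih =>
    have h1 := rPoly_eq_sum_doublePoly hφ hψ b u
    have h2 := rPoly_eq_sum_doublePoly hψ hφ b u
    simp only [and_comm (a := pos (ψ _) = _)] at h2
    have hb : b ∈ Finset.univ.filter fun c => pos (φ c) = pos (φ b) ∧ pos (ψ c) = pos (ψ b) := by
      simp
    rw [← Finset.add_sum_erase _ _ hb, rPoly_self, one_mul] at h1 h2
    rw [h1] at h2
    have : ∀ c ∈ (Finset.univ.filter fun c => pos (φ c) = pos (φ b) ∧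
        pos (ψ c) = pos (ψ b)).erase b,
        rPoly b c * doublePoly φ ψ c u = rPoly b c * doublePoly ψ φ c u := by
      intro c hc
      by_cases h : rPoly b c = 0
      · rw [h, zero_mul, zero_mul]
      · rcases (le_of_rPoly_ne_zero h).eq_or_length_lt with h | h
        · exact absurd h (Finset.mem_erase.1 hc).1
        · rw [ih _ (hk ▸ h) c rfl]
    rw [Finset.sum_congr rfl this] at h2
    exact add_right_cancel h2

open Classical in
/-- The intermediate vertices of the double shortcuts of total length `k` from `u` to `b`. -/
noncomputable def doubleVertices (φ ψ : Perm (Fin (m + 1)) ≃ Perm (Fin (m + 1)))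
    (u b : Perm (Fin (m + 1))) (k : ℕ) : Finset (Perm (Fin (m + 1))) :=
  {p | (pos (φ p) = pos (φ b) ∧ IsShift (φ u) (φ p) ∧ IsShift (ψ p) (ψ b)) ∧
    dist u p + dist p b = k}

theorem coeff_doublePoly (hφ : IsAut φ) (hψ : IsAut ψ) (u b : Perm (Fin (m + 1))) (k : ℕ) :
    (doublePoly φ ψ b u).coeff k = (doubleVertices φ ψ u b k).card := by
  classical
  rw [doublePoly, finsetSum_coeff, Finset.sum_filter, doubleVertices, Finset.card_filter,
    Nat.cast_sum]
  refine Finset.sum_congr rfl fun p _ => ?_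
  rw [shiftPoly_apply, shiftPoly_apply, hφ.dist_eq, hψ.dist_eq]
  by_cases h1 : pos (φ p) = pos (φ b) <;> by_cases h2 : IsShift (φ u) (φ p) <;>
    by_cases h3 : IsShift (ψ p) (ψ b) <;>
    simp [h1, h2, h3, ← pow_add, coeff_X_pow, eq_comm]

theorem card_doubleVertices_comm (hφ : PreservesR φ) (hψ : PreservesR ψ)
    (u b : Perm (Fin (m + 1))) (k : ℕ) :
    (doubleVertices φ ψ u b k).card = (doubleVertices ψ φ u b k).card := by
  have := congrArg (fun P : ℤ[X] => P.coeff k) (doublePoly_comm hφ hψ b u)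
  simp only [coeff_doublePoly hφ.toIsAut hψ.toIsAut, coeff_doublePoly hψ.toIsAut hφ.toIsAut] at this
  exact_mod_cast this

variable {u v z z' : Perm (Fin (m + 1))}

/-- Separates a condition on `b` and `v`, symmetric in `φ` and `ψ`, from a condition on `p` that no
longer mentions `v`; the latter is what `doublePoly` counts. -/
theorem mem_shortcuts_and_iff (hφ : IsAut φ) (hψ : IsAut ψ) (hz : IsStandard φ u v z)
    (hz' : IsStandard ψ u v z') {p b : Perm (Fin (m + 1))} :
    (p ∈ shortcuts u v z ∧ ∃ w, IsJoin v z' p w ∧ b ∈ shortcuts p v w) ↔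
      (LE b v ∧ pos (φ b) = pos (φ v) ∧ pos (ψ b) = pos (ψ v)) ∧
        (pos (φ p) = pos (φ b) ∧ IsShift (φ u) (φ p) ∧ IsShift (ψ p) (ψ b)) := by
  rw [hz.mem_shortcuts_iff hφ]
  constructor
  · rintro ⟨⟨hpv, hp, hs⟩, w, hw, hb⟩
    rw [hz'.isJoin_iff hψ ⟨hφ.le_iff.1 hs.le, hpv⟩] at hw
    rw [hw.mem_shortcuts_iff hψ] at hb
    obtain ⟨hbv, hb, hs'⟩ := hb
    have h1 : pos (φ b) = pos (φ v) := by
      refine le_antisymm ?_ (hφ.pos_le hbv)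
      rw [← hp]
      exact hφ.pos_le (hψ.le_iff.1 hs'.le)
    exact ⟨⟨hbv, h1, hb⟩, hp.trans h1.symm, hs, hs'⟩
  · rintro ⟨⟨hbv, h1, hb⟩, hp, hs, hs'⟩
    have hpv : LE p v := (hψ.le_iff.1 hs'.le).trans hbv
    obtain ⟨w, hw⟩ := exists_isStandard hψ hpv
    exact ⟨⟨hpv, hp.trans h1, hs⟩, w, (hz'.isJoin_iff hψ ⟨hφ.le_iff.1 hs.le, hpv⟩).2 hw,
      (hw.mem_shortcuts_iff hψ).2 ⟨hbv, hb, hs'⟩⟩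

open Classical in
theorem count_doubleShortcuts (hφ : IsAut φ) (hψ : IsAut ψ) (hz : IsStandard φ u v z)
    (hz' : IsStandard ψ u v z') (k : ℕ) (b : Perm (Fin (m + 1))) :
    (doubleShortcuts u v z z').count (k, b) =
      if LE b v ∧ pos (φ b) = pos (φ v) ∧ pos (ψ b) = pos (ψ v) then
        (doubleVertices φ ψ u b k).card else 0 := by
  rw [doubleShortcuts, Multiset.count_map, ← Finset.filter_val, Finset.card_val,
    Finset.filter_filter]
  simp only [mem_shortcuts_and_iff hφ hψ hz hz', Prod.mk.injEq]
  split_ifs with h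
  · rw [← Finset.card_image_of_injective (doubleVertices φ ψ u b k)
      (f := fun p => (p, b)) fun p q hpq => (Prod.mk.inj hpq).1]
    congr 1
    ext ⟨p, c⟩
    simp only [doubleVertices, Finset.mem_filter, Finset.mem_univ, true_and, Finset.mem_image,
      Prod.mk.injEq]
    constructor
    · rintro ⟨⟨-, h1⟩, h2, rfl⟩
      exact ⟨p, ⟨h1, h2.symm⟩, rfl, rfl⟩
    · rintro ⟨q, ⟨h1, h2⟩, rfl, rfl⟩
      exact ⟨⟨h, h1⟩, h2.symm, rfl⟩
  · rw [Finset.card_eq_zero, Finset.filter_eq_empty_iff]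
    rintro ⟨p, c⟩ - ⟨⟨h1, -⟩, -, rfl⟩
    exact h h1

theorem doubleShortcuts_comm (hφ : PreservesR φ) (hψ : PreservesR ψ) (hz : IsStandard φ u v z)
    (hz' : IsStandard ψ u v z') : doubleShortcuts u v z z' = doubleShortcuts u v z' z := by
  classical
  refine Multiset.ext.2 fun ⟨k, b⟩ => ?_
  have h1 := count_doubleShortcuts hφ.toIsAut hψ.toIsAut hz hz' k b
  have h2 := count_doubleShortcuts hψ.toIsAut hφ.toIsAut hz' hz k b
  rw [card_doubleVertices_comm hφ hψ] at h1
  simp only [and_comm (a := pos (ψ _) = _)] at h2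
  convert h1.trans h2.symm

end

/-! ### The four standard automorphisms -/

theorem preservesR_refl : PreservesR (Equiv.refl (Perm (Fin (m + 1)))) :=
  ⟨⟨Iff.rfl⟩, fun _ _ => rfl⟩

theorem preservesR_inv : PreservesR (Equiv.inv (Perm (Fin (m + 1)))) :=
  ⟨⟨⟨fun h => by simpa using h.inv, Edge.inv⟩⟩, rPoly_inv⟩

/-- `revConj` as an equivalence. -/
def revConjEquiv : Perm (Fin (m + 1)) ≃ Perm (Fin (m + 1)) where
  toFun := revConj
  invFun := revConj
  left_inv := revConj_revConj
  right_inv := revConj_revConj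

theorem preservesR_revConj : PreservesR (revConjEquiv (m := m)) :=
  ⟨⟨⟨fun h => by simpa [revConjEquiv, revConj_revConj] using h.revConj, Edge.revConj⟩⟩,
    rPoly_revConj⟩

theorem PreservesR.trans {φ ψ : Perm (Fin (m + 1)) ≃ Perm (Fin (m + 1))} (hφ : PreservesR φ)
    (hψ : PreservesR ψ) : PreservesR (φ.trans ψ) :=
  ⟨⟨hψ.edge_iff.trans hφ.edge_iff⟩, fun _ _ => (hψ.rPoly_eq _ _).trans (hφ.rPoly_eq _ _)⟩

theorem pos_inv (x : Perm (Fin (m + 1))) : pos x⁻¹ = x (Fin.last m) := by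
  rw [pos, inv_inv]

theorem pos_revConj (x : Perm (Fin (m + 1))) : pos (revConj x) = Fin.rev (x⁻¹ 0) := by
  rw [pos, ← revConj_inv, revConj_apply, Fin.rev_last]

/-! ### Parabolic subgroups -/

/-- The parabolic subgroup is the stabilizer of the first `k` points. Conversely, a permutation in
the stabilizer has no descent across the boundary, so it is reduced to `1` by the allowed simple
transpositions. -/
theorem mem_parabolic_iff {k : ℕ} {w : Perm (Fin (m + 1))} :
    w ∈ parabolic (m + 1) k ↔ ∀ i, (w i).val < k ↔ i.val < k := by
  constructor
  · intro h
    induction h using Subgroup.closure_induction with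
    | mem s hs =>
      obtain ⟨j, hj, hjk, rfl⟩ := hs
      intro i
      rw [swap_apply_def]
      split_ifs with h1 h2
      · subst h1; simp only; omega
      · subst h2; simp only; omega
      · rfl
    | one => simp
    | mul x y _ _ hx hy => exact fun i => (hx _).trans (hy i)
    | inv x _ hx =>
      intro i
      rw [← hx]
      simp
  · intro h
    induction hk : length w using Nat.strong_induction_on generalizing w with
    | _ l ih =>
      by_cases hw : w = 1
      · exact hw ▸ one_mem _
      obtain ⟨i, hi⟩ := exists_not_isAscent hw
      have hik : i.val + 1 ≠ k := by
        intro hik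
        have h1 := h i.castSucc
        have h2 := h i.succ
        rw [IsAscent, Fin.lt_def] at hi
        simp only [Fin.val_castSucc, Fin.val_succ] at h1 h2
        omega
      have hs : simple i ∈ parabolic (m + 1) k :=
        Subgroup.subset_closure ⟨i, by omega, hik, rfl⟩
      have hsk : ∀ j, (simple i j).val < k ↔ j.val < k := by
        intro j
        rw [simple, swap_apply_def]
        split_ifs with h1 h2
        · subst h1; simp only [Fin.val_castSucc, Fin.val_succ]; omega
        · subst h2; simp only [Fin.val_castSucc, Fin.val_succ]; omega
        · rfl
      have hlt := (isAscent_mul_simple.2 hi).edge.2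
      rw [mul_simple_mul_simple, hk] at hlt
      have := mul_mem (ih _ hlt (fun j => (h (simple i j)).trans (hsk j)) rfl) hs
      rwa [mul_simple_mul_simple] at this

theorem mem_parabolic_last_iff {w : Perm (Fin (m + 1))} :
    w ∈ parabolic (m + 1) m ↔ w (Fin.last m) = Fin.last m := by
  have key : ∀ i : Fin (m + 1), i.val < m ↔ i ≠ Fin.last m := fun i => by
    rw [← Fin.lt_last_iff_ne_last, Fin.lt_def, Fin.val_last]
  simp only [mem_parabolic_iff, key, not_iff_not]
  exact ⟨fun h => (h _).2 rfl, fun h i => ⟨fun hi => w.injective (hi.trans h.symm),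
    fun hi => by rw [hi, h]⟩⟩

theorem mem_parabolic_one_iff {w : Perm (Fin (m + 1))} :
    w ∈ parabolic (m + 1) 1 ↔ w 0 = 0 := by
  simp only [mem_parabolic_iff, Nat.lt_one_iff, Fin.val_eq_zero_iff]
  exact ⟨fun h => (h _).2 rfl, fun h i => ⟨fun hi => w.injective (hi.trans h.symm),
    fun hi => by rw [hi, h]⟩⟩

theorem exists_mul_right_iff {G : Type*} [Group G] {H : Subgroup G} {x v : G} :
    (∃ w ∈ H, x = w * v) ↔ x * v⁻¹ ∈ H := by
  constructor
  · rintro ⟨w, hw, rfl⟩; simpa using hw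
  · intro h; exact ⟨_, h, by simp⟩

theorem exists_mul_left_iff {G : Type*} [Group G] {H : Subgroup G} {x v : G} :
    (∃ w ∈ H, x = v * w) ↔ v⁻¹ * x ∈ H := by
  constructor
  · rintro ⟨w, hw, rfl⟩; simpa using hw
  · intro h; exact ⟨_, h, by simp⟩

section

variable {u v z : Perm (Fin (m + 1))}

theorem isLeftStandard_iff {φ : Perm (Fin (m + 1)) ≃ Perm (Fin (m + 1))} {k : ℕ}
    (h : ∀ x, x * v⁻¹ ∈ parabolic (m + 1) k ↔ pos (φ x) = pos (φ v)) :
    IsLeftStandard k u v z ↔ IsStandard φ u v z := by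
  simp only [IsLeftStandard, IsStandard, exists_mul_right_iff, h]

theorem isRightStandard_iff {φ : Perm (Fin (m + 1)) ≃ Perm (Fin (m + 1))} {k : ℕ}
    (h : ∀ x, v⁻¹ * x ∈ parabolic (m + 1) k ↔ pos (φ x) = pos (φ v)) :
    IsRightStandard k u v z ↔ IsStandard φ u v z := by
  simp only [IsRightStandard, IsStandard, exists_mul_left_iff, h]

theorem isLeftStandard_last_iff :
    IsLeftStandard m u v z ↔ IsStandard (Equiv.refl _) u v z :=
  isLeftStandard_iff fun x => by
    rw [mem_parabolic_last_iff, Equiv.refl_apply, Equiv.refl_apply, pos_eq_iff]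
    rfl

theorem isLeftStandard_one_iff :
    IsLeftStandard 1 u v z ↔ IsStandard revConjEquiv u v z :=
  isLeftStandard_iff fun x => by
    change _ ↔ pos (revConj x) = pos (revConj v)
    rw [mem_parabolic_one_iff, pos_revConj, pos_revConj, Fin.rev_inj, Perm.inv_eq_iff_eq, eq_comm]
    rfl

theorem isRightStandard_last_iff :
    IsRightStandard m u v z ↔ IsStandard (Equiv.inv _) u v z :=
  isRightStandard_iff fun x => by
    change _ ↔ pos x⁻¹ = pos v⁻¹
    rw [mem_parabolic_last_iff, pos_inv, pos_inv, Perm.mul_apply, Perm.inv_eq_iff_eq]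

theorem isRightStandard_one_iff :
    IsRightStandard 1 u v z ↔ IsStandard ((Equiv.inv _).trans revConjEquiv) u v z :=
  isRightStandard_iff fun x => by
    change _ ↔ pos (revConj x⁻¹) = pos (revConj v⁻¹)
    rw [mem_parabolic_one_iff, pos_revConj, pos_revConj, inv_inv, inv_inv, Fin.rev_inj,
      Perm.mul_apply, Perm.inv_eq_iff_eq]

end

/-- The four minima exist, are amazing hypercube decompositions and lie in one class. -/
theorem exists_standard_sameClass {u v : Perm (Fin (m + 1))} (huv : LE u v) :
    ∃ a b c d : Amazing u v,
      IsLeftStandard m u v a ∧ IsLeftStandard 1 u v b ∧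
      IsRightStandard m u v c ∧ IsRightStandard 1 u v d ∧
      SameClass u v a b ∧ SameClass u v a c ∧ SameClass u v a d := by
  have hi := preservesR_inv.trans (preservesR_revConj (m := m))
  obtain ⟨a, ha⟩ := exists_isStandard preservesR_refl.toIsAut huv
  obtain ⟨b, hb⟩ := exists_isStandard preservesR_revConj.toIsAut huv
  obtain ⟨c, hc⟩ := exists_isStandard preservesR_inv.toIsAut huv
  obtain ⟨d, hd⟩ := exists_isStandard hi.toIsAut huv
  exact ⟨⟨a, ha.isAmazing preservesR_refl.toIsAut⟩, ⟨b, hb.isAmazing preservesR_revConj.toIsAut⟩,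
    ⟨c, hc.isAmazing preservesR_inv.toIsAut⟩, ⟨d, hd.isAmazing hi.toIsAut⟩,
    isLeftStandard_last_iff.2 ha, isLeftStandard_one_iff.2 hb, isRightStandard_last_iff.2 hc,
    isRightStandard_one_iff.2 hd,
    .rel _ _ (doubleShortcuts_comm preservesR_refl preservesR_revConj ha hb),
    .rel _ _ (doubleShortcuts_comm preservesR_refl preservesR_inv ha hc),
    .rel _ _ (doubleShortcuts_comm preservesR_refl hi ha hd)⟩

/-- Serves the case `n = 0`, where there is no largest value. -/
theorem isAmazing_of_subsingleton {n : ℕ} [Subsingleton (Perm (Fin n))] (u v z : Perm (Fin n)) :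
    IsAmazing u v z := by
  have hLE : ∀ x y : Perm (Fin n), LE x y := fun x y => Subsingleton.elim x y ▸ LE.refl x
  have hint : ∀ x y z : Perm (Fin n), z ∈ interval x y := fun x y z => ⟨hLE _ _, hLE _ _⟩
  have hHD : ∀ x y z : Perm (Fin n), IsHypercubeDecomposition x y z := fun x y z => by
    refine ⟨hint _ _ _, fun x _ _ _ _ _ _ _ _ _ _ _ _ => hint _ _ _, fun p _ E hE _ => ?_⟩
    obtain rfl : E = ∅ := Set.eq_empty_of_forall_notMem fun x hx => (hE hx).1.2 (hint _ _ _)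
    refine ⟨fun _ => p, ⟨⟨fun A B _ => Subsingleton.elim A B, ?_⟩, rfl, fun a => a.2.elim⟩,
      fun θ _ => funext fun A => Subsingleton.elim _ _⟩
    rintro A B ⟨a, -⟩
    exact a.2.elim
  exact ⟨hHD _ _ _, fun x _ => ⟨x, ⟨⟨hint _ _ _, hint _ _ _⟩, fun y _ => hLE _ _⟩, hHD _ _ _⟩⟩

theorem exists_standard_sameClass_of_subsingleton {n k : ℕ} [Subsingleton (Perm (Fin n))]
    (u v : Perm (Fin n)) :
    ∃ a b c d : Amazing u v,
      IsLeftStandard k u v a ∧ IsLeftStandard 1 u v b ∧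
      IsRightStandard k u v c ∧ IsRightStandard 1 u v d ∧
      SameClass u v a b ∧ SameClass u v a c ∧ SameClass u v a d := by
  have hLE : ∀ x y : Perm (Fin n), LE x y := fun x y => Subsingleton.elim x y ▸ LE.refl x
  let a : Amazing u v := ⟨u, isAmazing_of_subsingleton u v u⟩
  have hL : ∀ k, IsLeftStandard k u v u := fun k =>
    ⟨⟨⟨hLE _ _, hLE _ _⟩, 1, one_mem _, Subsingleton.elim _ _⟩, fun _ _ => hLE _ _⟩
  have hR : ∀ k, IsRightStandard k u v u := fun k =>
    ⟨⟨⟨hLE _ _, hLE _ _⟩, 1, one_mem _, Subsingleton.elim _ _⟩, fun _ _ => hLE _ _⟩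
  exact ⟨a, a, a, a, hL k, hL 1, hR k, hR 1, .refl _, .refl _, .refl _⟩

end

end BruhatSn


theorem corollary3p3 (n : ℕ) (u v : Equiv.Perm (Fin n)) (huv : BruhatSn.LE u v) :
    ∃ a b c d : BruhatSn.Amazing u v,
      BruhatSn.IsLeftStandard (n - 1) u v a ∧ BruhatSn.IsLeftStandard 1 u v b ∧
      BruhatSn.IsRightStandard (n - 1) u v c ∧ BruhatSn.IsRightStandard 1 u v d ∧
      BruhatSn.SameClass u v a b ∧ BruhatSn.SameClass u v a c ∧ BruhatSn.SameClass u v a d ∧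
      ((∀ z, BruhatSn.IsHypercubeDecomposition u v z →
          z = a.1 ∨ z = b.1 ∨ z = c.1 ∨ z = d.1) →
        ∀ z z' : BruhatSn.Amazing u v, BruhatSn.SameClass u v z z') := by
  open BruhatSn in
  have key : ∃ a b c d : Amazing u v,
      IsLeftStandard (n - 1) u v a ∧ IsLeftStandard 1 u v b ∧
      IsRightStandard (n - 1) u v c ∧ IsRightStandard 1 u v d ∧
      SameClass u v a b ∧ SameClass u v a c ∧ SameClass u v a d := by
    cases n with
    | zero => exact exists_standard_sameClass_of_subsingleton u v
    | succ m => exact exists_standard_sameClass huv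
  obtain ⟨a, b, c, d, ha, hb, hc, hd, hab, hac, had⟩ := key
  refine ⟨a, b, c, d, ha, hb, hc, hd, hab, hac, had, fun h => ?_⟩
  have hz : ∀ z : BruhatSn.Amazing u v, BruhatSn.SameClass u v a z := by
    intro z
    rcases h z.1 z.2.isHypercubeDecomposition with h | h | h | h
    · rw [Subtype.ext h]; exact .refl _
    · rw [Subtype.ext h]; exact hab
    · rw [Subtype.ext h]; exact hac
    · rw [Subtype.ext h]; exact had
  exact fun z z' => .trans _ _ _ (.symm _ _ (hz z)) (hz z')
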